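/- Let $\mathcal D$ be the collection of dyadic intervals $[k2^n,(k+1)2^n)$, $n,k\in\mathbb Z$, of the real line. For $I\in\mathcal D$ with left and right halves $I_-,I_+$ let $h_I=|I|^{-1/2}(\chi_{I_-}-\chi_{I_+})$ be the Haar function, and let $\langle f\rangle_I=\frac1{|I|}\int_I f\,dx$. For a sequence of signs $\sigma=(\sigma_I)_{I\in\mathcal D}$, $\sigma_I\in\{1,-1\}$, let $$T_\sigma f=\sum_{I\in\mathcal D}\sigma_I\,(f,h_I)\,h_I,\qquad (f,h_I)=\int_{\mathbb R} f\,h_I\,dx .$$ Let $v,w$ be weights on $\mathbb R$, i.e. nonnegative locally integrable functions, and let $M_v^{1/2},M_w^{1/2}$ denote multiplication by $v^{1/2},w^{1/2}$. Then the operators $M_v^{1/2}T_\sigma M_w^{1/2}$ are bounded on $L^2(\mathbb R)$ uniformly over all sign sequences $\sigma$ if and only if there is a constant $C<\infty$ such that for every $J\in\mathcal D$ $$\text{(1)}\quad \sup_\sigma\frac1{|J|}\int_J|T_\sigma(\chi_Jw)|^2\,v\,dx\le C\langle w\rangle_J,\qquad \text{(2)}\quad \sup_\sigma\frac1{|J|}\int_J|T_\sigma(\chi_Jv)|^2\,w\,dx\le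 C\langle v\rangle_J .$$ Here the series for $T_\sigma$ is understood to converge unconditionally in the $L^2$ space of the output weight: in $L^2(v\,dx)$ for $T_\sigma(w^{1/2}f)$, $f\in L^2(\mathbb R)$, and in $L^2(J,v\,dx)$, respectively $L^2(J,w\,dx)$, for $T_\sigma(\chi_Jw)$ in (1), respectively $T_\sigma(\chi_Jv)$ in (2); this convergence is part of the boundedness of the operators and of conditions (1) and (2). -/

import Mathlib

open MeasureTheory Filter Topology

noncomputable section

/-- A dyadic interval `I = [k 2ⁿ, (k+1) 2ⁿ)` of the real line, with `n, k ∈ ℤ`.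
Distinct pairs `(n, k)` give distinct intervals, so this type indexes the collection `𝒟`. -/
structure DyadicInterval where
  scale : ℤ
  index : ℤ

namespace DyadicInterval

/-- The length `|I| = 2ⁿ`. -/
def length (I : DyadicInterval) : ℝ := (2 : ℝ) ^ I.scale

/-- The underlying set of points. -/
def toSet (I : DyadicInterval) : Set ℝ :=
  Set.Ico ((I.index : ℝ) * I.length) (((I.index : ℝ) + 1) * I.length)

/-- The left half `I₋`. -/
def leftHalf (I : DyadicInterval) : Set ℝ :=
  Set.Ico ((I.index : ℝ) * I.length) (((I.index : ℝ) + 1 / 2) * I.length)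

/-- The right half `I₊`. -/
def rightHalf (I : DyadicInterval) : Set ℝ :=
  Set.Ico (((I.index : ℝ) + 1 / 2) * I.length) (((I.index : ℝ) + 1) * I.length)

/-- The Haar function: `|I|^{-1/2}` on `I₋`, `-|I|^{-1/2}` on `I₊`, and `0` off `I`. -/
def haar (I : DyadicInterval) (x : ℝ) : ℝ :=
  I.leftHalf.indicator (fun _ => (√I.length)⁻¹) x -
    I.rightHalf.indicator (fun _ => (√I.length)⁻¹) x

/-- The Haar coefficient `(f, h_I) = ∫ f h_I dx`. -/
def haarCoeff (f : ℝ → ℝ) (I : DyadicInterval) : ℝ := ∫ x, f x * I.haar x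

/-- The average `⟨w⟩_I` of `w` over `I`. -/
def average (w : ℝ → ℝ) (I : DyadicInterval) : ℝ := I.length⁻¹ * ∫ x in I.toSet, w x

end DyadicInterval

/-- The partial sum over the finite family `F` of the series
`T_σ f = ∑_{I ∈ 𝒟} σ_I (f, h_I) h_I`. -/
def haarPartialSum (σ : DyadicInterval → ℤˣ) (f : ℝ → ℝ) (F : Finset DyadicInterval)
    (x : ℝ) : ℝ :=
  ∑ I ∈ F, ((σ I : ℤ) : ℝ) * I.haarCoeff f * I.haar x

/-- The measure `v dx`. -/
def weightMeasure (v : ℝ → ℝ) : Measure ℝ :=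
  volume.withDensity (fun x => ENNReal.ofReal (v x))

/-- `T_σ f = g`, where the series defining `T_σ f` converges to `g` in `L²(μ)`, independently of
the order of summation. (This is applied when every partial sum lies in `L²(μ)`; then so
does `g`.) -/
def HasHaarTransform (μ : Measure ℝ) (σ : DyadicInterval → ℤˣ) (f g : ℝ → ℝ) : Prop :=
  AEStronglyMeasurable g μ ∧
    Tendsto (fun F : Finset DyadicInterval =>
      eLpNorm (fun x => haarPartialSum σ f F x - g x) 2 μ) atTop (𝓝 0)

/-- `A` is the operator `M_v^{1/2} T_σ M_w^{1/2}` on `L²(ℝ)`, i.e. for every `f ∈ L²` the series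
`T_σ (w^{1/2} f)` converges in `L²(v dx)`, and `A f = v^{1/2} T_σ (w^{1/2} f)`. -/
def IsWeightedHaarMultiplier (v w : ℝ → ℝ) (σ : DyadicInterval → ℤˣ)
    (A : Lp ℝ 2 (volume : Measure ℝ) →L[ℝ] Lp ℝ 2 (volume : Measure ℝ)) : Prop :=
  ∀ f : Lp ℝ 2 (volume : Measure ℝ), ∃ g : ℝ → ℝ,
    HasHaarTransform (weightMeasure v) σ (fun x => √(w x) * f x) g ∧
      A f =ᵐ[volume] fun x => √(v x) * g x

/-- All the operators `M_v^{1/2} T_σ M_w^{1/2}` are bounded on `L²(ℝ)`, with norms bounded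
uniformly in the sign sequence `σ`. -/
def HaarMultipliersUniformlyBounded (v w : ℝ → ℝ) : Prop :=
  ∃ C : ℝ, ∀ σ : DyadicInterval → ℤˣ,
    ∃ A : Lp ℝ 2 (volume : Measure ℝ) →L[ℝ] Lp ℝ 2 (volume : Measure ℝ),
      IsWeightedHaarMultiplier v w σ A ∧ ‖A‖ ≤ C

/-- The testing condition: for some `C` and all dyadic `J`,
`sup_σ |J|⁻¹ ∫_J |T_σ (χ_J w)|² v dx ≤ C ⟨w⟩_J`, where on `J` the series `T_σ (χ_J w)` converges
in `L²(v dx)`. -/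
def HaarTesting (v w : ℝ → ℝ) : Prop :=
  ∃ C : ℝ, ∀ (J : DyadicInterval) (σ : DyadicInterval → ℤˣ), ∃ g : ℝ → ℝ,
    HasHaarTransform ((weightMeasure v).restrict J.toSet) σ (J.toSet.indicator w) g ∧
      J.length⁻¹ * ∫ x in J.toSet, |g x| ^ 2 * v x ≤ C * J.average w

end

/-! ### Choice of signs in a Hilbert space -/

section Hilbert

variable {ι H : Type*} [NormedAddCommGroup H] [InnerProductSpace ℝ H]

/-! Put x_I = w^{1/2} h_I and y_I = v^{1/2} h_I in L²(ℝ). The operator is f ↦ ∑ σ_I ⟨f, x_I⟩ y_I. As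
all signs are allowed, uniform boundedness amounts to ∑ |⟨f, x_I⟩| |⟨g, y_I⟩| ≤ C ‖f‖ ‖g‖
(`AbsBilinearBound`), a condition symmetric in the two weights. Necessity of testing follows by
inserting f = w^{1/2} χ_J.

For sufficiency, split x_I = κ_I + (c_I / w(I)) w^{1/2} χ_I with c_I = ∫ w h_I, and y_I likewise
with c'_I and v. The κ_I are the unnormalized weighted Haar functions: they are orthogonal and
satisfy a Bessel inequality (`IsHaarGram.bessel`). The form splits into four pieces. The piece with
two κ's is controlled by w(J) v(J) ≤ C |J|², which comes from testing the Haar function of the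
parent of J (`integral_mul_integral_le_of_testing`). The two mixed pieces are controlled by
`carleson_embedding`. The required Carleson condition on c_I² v(I) / |I| holds because a suitable
choice of signs turns testing into a square-sum bound (`IsHaarGram.carleson_of_testing`). The last
piece is the positive form with coefficients |c_I c'_I| acting on weighted averages, controlled by
`bilinear_embedding`.

Both embeddings group the intervals by dyadic levels of the averages (`exists_isStopping`). The
stopping intervals are sparse enough for their indicators to be almost orthogonal
(`norm_sq_sum_smul_le`). -/

theorem exists_sign_norm_sq_add_le (a b : H) :
    ∃ s : ℤˣ, ‖a‖ ^ 2 + ‖b‖ ^ 2 ≤ ‖a + ((s : ℤ) : ℝ) • b‖ ^ 2 := by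
  have h := parallelogram_law_with_norm ℝ a b
  by_cases h1 : ‖a‖ ^ 2 + ‖b‖ ^ 2 ≤ ‖a + b‖ ^ 2
  · exact ⟨1, by simpa using h1⟩
  · refine ⟨-1, ?_⟩
    have : a + (((-1 : ℤˣ) : ℤ) : ℝ) • b = a - b := by simp [sub_eq_add_neg]
    rw [this]
    nlinarith

/-- The parallelogram law lets the signs be chosen one at a time; this replaces averaging over
random signs. -/
theorem exists_signs_sum_norm_sq_le (z : ι → H) (F : Finset ι) :
    ∃ ε : ι → ℤˣ, ∑ i ∈ F, ‖z i‖ ^ 2 ≤ ‖∑ i ∈ F, ((ε i : ℤ) : ℝ) • z i‖ ^ 2 := by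
  classical
  induction F using Finset.induction_on with
  | empty => exact ⟨fun _ => 1, by simp⟩
  | insert a F ha ih =>
    obtain ⟨ε, hε⟩ := ih
    obtain ⟨s, hs⟩ := exists_sign_norm_sq_add_le (∑ i ∈ F, ((ε i : ℤ) : ℝ) • z i) (z a)
    refine ⟨Function.update ε a s, ?_⟩
    rw [Finset.sum_insert ha, Finset.sum_insert ha]
    have : ∑ i ∈ F, (((Function.update ε a s) i : ℤ) : ℝ) • z i =
        ∑ i ∈ F, ((ε i : ℤ) : ℝ) • z i :=
      Finset.sum_congr rfl fun i hi => by
        rw [Function.update_of_ne (ne_of_mem_of_not_mem hi ha)]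
    rw [this, Function.update_self, add_comm (((s : ℤ) : ℝ) • z a)]
    linarith

/-- A series in a Hilbert space whose signed partial sums are bounded is summable. -/
theorem summable_of_signed_sums_bounded [CompleteSpace H] (z : ι → H) (M : ℝ)
    (hM : ∀ (F : Finset ι) (ε : ι → ℤˣ), ‖∑ i ∈ F, ((ε i : ℤ) : ℝ) • z i‖ ≤ M) :
    Summable z := by
  classical
  rw [summable_iff_vanishing_norm]
  intro δ hδ
  set S : Set ℝ := Set.range fun p : Finset ι × (ι → ℤˣ) =>
    ‖∑ i ∈ p.1, ((p.2 i : ℤ) : ℝ) • z i‖ ^ 2 with hS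
  have hbdd : BddAbove S := by
    refine ⟨M ^ 2, ?_⟩
    rintro _ ⟨p, rfl⟩
    exact pow_le_pow_left₀ (norm_nonneg _) (hM p.1 p.2) 2
  have hne : S.Nonempty := Set.range_nonempty _
  -- Take a signed sum whose squared norm is within `δ ^ 2` of the supremum. A block disjoint from
  -- `F`, added with a good sign, raises the square by at least its own squared norm, so that norm
  -- is below `δ`.
  obtain ⟨_, ⟨⟨F, ε⟩, rfl⟩, hF⟩ :=
    exists_lt_of_lt_csSup hne (show sSup S - δ ^ 2 < sSup S by nlinarith)
  refine ⟨F, fun G hG => ?_⟩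
  obtain ⟨s, hs⟩ := exists_sign_norm_sq_add_le (∑ i ∈ F, ((ε i : ℤ) : ℝ) • z i) (∑ i ∈ G, z i)
  have key : ∑ i ∈ F, ((ε i : ℤ) : ℝ) • z i + ((s : ℤ) : ℝ) • ∑ i ∈ G, z i =
      ∑ i ∈ F ∪ G, (((if i ∈ F then ε i else s : ℤˣ) : ℤ) : ℝ) • z i := by
    rw [Finset.sum_union hG.symm, Finset.smul_sum]
    congr 1
    · exact Finset.sum_congr rfl fun i hi => by rw [if_pos hi]
    · exact Finset.sum_congr rfl fun i hi => by
        rw [if_neg (Finset.disjoint_left.mp hG hi)]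
  rw [key] at hs
  have h2 := le_csSup hbdd
    (show _ ∈ S from ⟨(F ∪ G, fun i => if i ∈ F then ε i else s), rfl⟩)
  simp only at h2 hF
  have : ‖∑ i ∈ G, z i‖ ^ 2 < δ ^ 2 := by linarith
  exact lt_of_pow_lt_pow_left₀ 2 hδ.le this

theorem exists_sign_mul_eq_abs (a : ℝ) : ∃ s : ℤˣ, ((s : ℤ) : ℝ) * a = |a| := by
  rcases le_total 0 a with h | h
  · exact ⟨1, by simp [abs_of_nonneg h]⟩
  · exact ⟨-1, by simp [abs_of_nonpos h]⟩

theorem abs_sign_cast (s : ℤˣ) : |((s : ℤ) : ℝ)| = 1 := by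
  rcases Int.units_eq_one_or s with rfl | rfl <;> simp

/-- If all the signed series `∑ ± z i` converge to vectors of norm at most `M`, then
`∑ |⟪φ, z i⟫| ≤ M ‖φ‖`. -/
theorem sum_abs_inner_le_of_signed_hasSum (z : ι → H) (M : ℝ)
    (h : ∀ ε : ι → ℤˣ, ∃ G : H, HasSum (fun i => ((ε i : ℤ) : ℝ) • z i) G ∧ ‖G‖ ≤ M)
    (φ : H) (F : Finset ι) : ∑ i ∈ F, |inner ℝ φ (z i)| ≤ M * ‖φ‖ := by
  choose ε hε using fun i => exists_sign_mul_eq_abs (inner ℝ φ (z i))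
  obtain ⟨G, hG, hGM⟩ := h ε
  have h1 : HasSum (fun i => |inner ℝ φ (z i)|) (inner ℝ φ G) := by
    have := (innerSL ℝ φ).hasSum hG
    simpa [inner_smul_right, hε] using this
  calc ∑ i ∈ F, |inner ℝ φ (z i)| ≤ inner ℝ φ G :=
        sum_le_hasSum F (fun i _ => abs_nonneg _) h1
    _ ≤ ‖φ‖ * ‖G‖ := real_inner_le_norm φ G
    _ ≤ M * ‖φ‖ := by rw [mul_comm]; gcongr

/-- Duality, with the signed sum itself as the test vector `φ`. -/
theorem norm_signed_sum_le (z : ι → H) {M : ℝ} (hM : 0 ≤ M) (F : Finset ι)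
    (h : ∀ φ : H, ∑ i ∈ F, |inner ℝ φ (z i)| ≤ M * ‖φ‖) (ε : ι → ℤˣ) :
    ‖∑ i ∈ F, ((ε i : ℤ) : ℝ) • z i‖ ≤ M := by
  set φ := ∑ i ∈ F, ((ε i : ℤ) : ℝ) • z i with hφ
  have h1 : ‖φ‖ ^ 2 ≤ M * ‖φ‖ := by
    calc ‖φ‖ ^ 2 = inner ℝ φ φ := (real_inner_self_eq_norm_sq φ).symm
      _ = ∑ i ∈ F, ((ε i : ℤ) : ℝ) * inner ℝ φ (z i) := by
          conv_lhs => rw [hφ, inner_sum]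
          exact Finset.sum_congr rfl fun i _ => by rw [inner_smul_right]
      _ ≤ ∑ i ∈ F, |inner ℝ φ (z i)| := Finset.sum_le_sum fun i _ => by
          refine (le_abs_self _).trans ?_
          rw [abs_mul, abs_sign_cast, one_mul]
      _ ≤ M * ‖φ‖ := h φ
  rcases (norm_nonneg φ).eq_or_lt with h0 | h0
  · rwa [← h0]
  · nlinarith

theorem sum_norm_sq_le_of_sum_abs_inner_le (z : ι → H) {M : ℝ} (hM : 0 ≤ M) (F : Finset ι)
    (h : ∀ φ : H, ∑ i ∈ F, |inner ℝ φ (z i)| ≤ M * ‖φ‖) : ∑ i ∈ F, ‖z i‖ ^ 2 ≤ M ^ 2 := by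
  obtain ⟨ε, hε⟩ := exists_signs_sum_norm_sq_le z F
  exact hε.trans (pow_le_pow_left₀ (norm_nonneg _) (norm_signed_sum_le z hM F h ε) 2)

/-- The bilinear form `∑ |⟪f, x i⟫ ⟪g, y i⟫|` is bounded with constant `C`. -/
def AbsBilinearBound (x y : ι → H) (C : ℝ) : Prop :=
  ∀ (F : Finset ι) (f g : H),
    ∑ i ∈ F, |inner ℝ f (x i)| * |inner ℝ g (y i)| ≤ C * ‖f‖ * ‖g‖

theorem AbsBilinearBound.symm {x y : ι → H} {C : ℝ} (h : AbsBilinearBound x y C) :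
    AbsBilinearBound y x C := fun F f g => by
  have := h F g f
  rw [mul_right_comm]
  simpa only [mul_comm |inner ℝ g (x _)|] using this

theorem AbsBilinearBound.of_hasSum {x y : ι → H} {C : ℝ}
    (h : ∀ σ : ι → ℤˣ, ∃ A : H →L[ℝ] H,
      (∀ f, HasSum (fun i => ((σ i : ℤ) : ℝ) • inner ℝ f (x i) • y i) (A f)) ∧ ‖A‖ ≤ C) :
    AbsBilinearBound x y C := by
  intro F f g
  have := sum_abs_inner_le_of_signed_hasSum (fun i => inner ℝ f (x i) • y i) (C * ‖f‖)
    (fun ε => by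
      obtain ⟨A, hA, hAC⟩ := h ε
      exact ⟨A f, hA f, (A.le_opNorm f).trans (by gcongr)⟩) g F
  simpa [inner_smul_right, abs_mul] using this

theorem AbsBilinearBound.exists_clm [CompleteSpace H] {x y : ι → H} {C : ℝ} (hC : 0 ≤ C)
    (h : AbsBilinearBound x y C) (σ : ι → ℤˣ) :
    ∃ A : H →L[ℝ] H,
      (∀ f, HasSum (fun i => ((σ i : ℤ) : ℝ) • inner ℝ f (x i) • y i) (A f)) ∧ ‖A‖ ≤ C := by
  have hb : ∀ f F (ε : ι → ℤˣ),
      ‖∑ i ∈ F, ((ε i : ℤ) : ℝ) • inner ℝ f (x i) • y i‖ ≤ C * ‖f‖ := fun f F ε =>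
    norm_signed_sum_le _ (by positivity) F (fun φ => by
      simpa [inner_smul_right, abs_mul] using h F f φ) ε
  have hs : ∀ f, Summable fun i => ((σ i : ℤ) : ℝ) • inner ℝ f (x i) • y i := fun f =>
    summable_of_signed_sums_bounded _ (C * ‖f‖) fun F ε => by
      have := hb f F (fun i => ε i * σ i)
      simpa [mul_smul] using this
  let L : H →ₗ[ℝ] H :=
    { toFun := fun f => ∑' i, ((σ i : ℤ) : ℝ) • inner ℝ f (x i) • y i
      map_add' := fun f g => by
        rw [← (hs f).tsum_add (hs g)]
        exact tsum_congr fun i => by rw [inner_add_left, add_smul, smul_add]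
      map_smul' := fun c f => by
        rw [RingHom.id_apply, ← tsum_const_smul'']
        exact tsum_congr fun i => by
          rw [real_inner_smul_left]; module }
  have hL : ∀ f, ‖L f‖ ≤ C * ‖f‖ := fun f =>
    le_of_tendsto (hs f).hasSum.norm (Eventually.of_forall fun F => hb f F σ)
  exact ⟨L.mkContinuous C hL, fun f => (hs f).hasSum, L.mkContinuous_norm_le hC hL⟩

end Hilbert

/-! ### Stopping levels and almost orthogonality on a forest -/

section Forest

theorem sum_two_zpow_le (K : Finset ℤ) : ∀ n : ℤ, (∀ k ∈ K, k ≤ n) →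
    ∑ k ∈ K, (2 : ℝ) ^ k ≤ 2 * 2 ^ n := by
  induction K using Finset.induction_on_max with
  | empty => intro n _; simp; positivity
  | insert a K ha ih =>
    intro n hn
    rw [Finset.sum_insert fun h => lt_irrefl _ (ha a h)]
    have h1 := ih (a - 1) fun k hk => by have := ha k hk; omega
    have h2 : (2 : ℝ) ^ a ≤ 2 ^ n :=
      zpow_le_zpow_right₀ (by norm_num) (hn a (Finset.mem_insert_self _ _))
    rw [zpow_sub_one₀ (by norm_num)] at h1
    linarith

theorem sum_two_zpow_comp_le {ι : Type*} (S : Finset ι) (k : ι → ℤ) (hk : Set.InjOn k S) (n : ℤ)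
    (hn : ∀ i ∈ S, k i ≤ n) : ∑ i ∈ S, (2 : ℝ) ^ k i ≤ 2 * 2 ^ n := by
  rw [← Finset.sum_image (f := fun j : ℤ => (2 : ℝ) ^ j) hk]
  exact sum_two_zpow_le _ n (by simpa using hn)

variable {ι H : Type*} [PartialOrder ι] [NormedAddCommGroup H] [InnerProductSpace ℝ H]

/-- In a forest, the elements above a given one form a chain. -/
def IsForest (ι : Type*) [PartialOrder ι] : Prop :=
  ∀ a b c : ι, a ≤ b → a ≤ c → b ≤ c ∨ c ≤ b

/-- The vectors `u i` have the inner products `m (i ∩ j)` of indicator functions of the members of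
a forest of sets, for a measure `m`. -/
structure IsForestGram (u : ι → H) (m : ι → ℝ) : Prop where
  inner_of_le : ∀ a b, a ≤ b → inner ℝ (u a) (u b) = m a
  inner_of_not_le : ∀ a b, ¬ a ≤ b → ¬ b ≤ a → inner ℝ (u a) (u b) = 0

theorem IsForestGram.norm_sq {u : ι → H} {m : ι → ℝ} (hu : IsForestGram u m) (i : ι) :
    ‖u i‖ ^ 2 = m i := by
  rw [← real_inner_self_eq_norm_sq, hu.inner_of_le i i le_rfl]

theorem IsForestGram.nonneg {u : ι → H} {m : ι → ℝ} (hu : IsForestGram u m) (i : ι) :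
    0 ≤ m i := hu.norm_sq i ▸ sq_nonneg _

theorem IsForestGram.inner_nonneg {u : ι → H} {m : ι → ℝ} (hu : IsForestGram u m) (i j : ι) :
    0 ≤ inner ℝ (u i) (u j) := by
  by_cases h1 : i ≤ j
  · rw [hu.inner_of_le i j h1]; exact hu.nonneg i
  · by_cases h2 : j ≤ i
    · rw [real_inner_comm, hu.inner_of_le j i h2]; exact hu.nonneg j
    · rw [hu.inner_of_not_le i j h1 h2]

/-- Stopping elements `top i` and levels `k` for a positive function `lam` on a finite set of
a forest. -/
structure IsStopping (F : Finset ι) (lam : ι → ℝ) (k : ι → ℤ) (top : ι → ι) : Prop where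
  mem : ∀ i ∈ F, top i ∈ F
  le : ∀ i ∈ F, i ≤ top i
  le_two_mul : ∀ i ∈ F, lam i ≤ 2 * 2 ^ k (top i)
  level_le : ∀ i ∈ F, 2 ^ k (top i) ≤ lam (top i)
  top_eq : ∀ i ∈ F, ∀ j ∈ F, i ≤ j → j ≤ top i → top j = top i
  level_lt : ∀ i ∈ F, ∀ j ∈ F, top i = i → top j = j → i < j → k j < k i

/-- The level of `i` is the integer part of log₂ of the largest value of `lam` at or above `i` in
`F`. It can only grow on descending, so the elements above `i` with the level of `i` form an initial
piece of a chain, and `top i` is its largest element. -/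
theorem exists_isStopping (hι : IsForest ι) (F : Finset ι) (lam : ι → ℝ)
    (hpos : ∀ i ∈ F, 0 < lam i) : ∃ k top, IsStopping F lam k top := by
  classical
  have hb : ∀ i, ∃ b, i ∈ F → b ∈ F ∧ i ≤ b ∧ ∀ j ∈ F, i ≤ j → lam j ≤ lam b := by
    intro i
    by_cases hi : i ∈ F
    · obtain ⟨b, hb, hb'⟩ := (F.filter (i ≤ ·)).exists_max_image lam ⟨i, by simp [hi]⟩
      simp only [Finset.mem_filter] at hb hb'
      exact ⟨b, fun _ => ⟨hb.1, hb.2, fun j h1 h2 => hb' j ⟨h1, h2⟩⟩⟩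
    · exact ⟨i, fun h => absurd h hi⟩
  choose b hb using hb
  set k : ι → ℤ := fun i => Int.log 2 (lam (b i)) with hk
  have kanti : ∀ i ∈ F, ∀ j ∈ F, i ≤ j → k j ≤ k i := fun i hi j hj hij =>
    Int.log_mono_right (hpos _ (hb j hj).1)
      ((hb i hi).2.2 _ (hb j hj).1 (hij.trans (hb j hj).2.1))
  have ht : ∀ i, ∃ t, i ∈ F → t ∈ F ∧ i ≤ t ∧ k t = k i ∧
      ∀ j ∈ F, i ≤ j → k j = k i → j ≤ t := by
    intro i
    by_cases hi : i ∈ F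
    · obtain ⟨t, ht⟩ := (F.filter (fun j => i ≤ j ∧ k j = k i)).exists_maximal ⟨i, by simp [hi]⟩
      have h1 := ht.prop
      simp only [Finset.mem_filter] at h1
      refine ⟨t, fun _ => ⟨h1.1, h1.2.1, h1.2.2, fun j hj hij hkj => ?_⟩⟩
      rcases hι i j t hij h1.2.1 with h | h
      · exact h
      · exact ht.le_of_ge (by simp [hj, hij, hkj]) h
    · exact ⟨i, fun h => absurd h hi⟩
  choose top ht using ht
  refine ⟨k, top, fun i hi => (ht i hi).1, fun i hi => (ht i hi).2.1, fun i hi => ?_,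
    fun i hi => ?_, fun i hi j hj hij hjt => ?_, fun i hi j hj hti _ hij => ?_⟩
  · have h1 : lam i ≤ lam (b i) := (hb i hi).2.2 i hi le_rfl
    have h2 := Int.lt_zpow_succ_log_self (b := 2) (by norm_num) (lam (b i))
    rw [(ht i hi).2.2.1]
    simp only [hk]
    rw [zpow_add_one₀ (by norm_num)] at h2
    push_cast at h2
    linarith
  -- The maximizer `b (top i)` lies above `top i` and has the same level, so by maximality it is
  -- `top i`: the level is attained there.
  · have hT := (ht i hi).1
    have hB := (hb _ hT).1
    have hTB := (hb _ hT).2.1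
    have e1 : lam (b (b (top i))) = lam (b (top i)) :=
      le_antisymm ((hb _ hT).2.2 _ (hb _ hB).1 (hTB.trans (hb _ hB).2.1))
        ((hb _ hB).2.2 _ hB le_rfl)
    have e2 : k (b (top i)) = k i := by
      rw [← (ht i hi).2.2.1]; simp only [hk, e1]
    have e3 : b (top i) = top i :=
      le_antisymm ((ht i hi).2.2.2 _ hB ((ht i hi).2.1.trans hTB) e2) hTB
    have := Int.zpow_log_le_self (b := 2) (by norm_num) (hpos _ hB)
    simp only [hk]
    rw [e3] at this ⊢
    exact_mod_cast this
  · have hkj : k j = k i := le_antisymm (kanti i hi j hj hij)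
      ((ht i hi).2.2.1 ▸ kanti j hj _ (ht i hi).1 hjt)
    refine le_antisymm ((ht i hi).2.2.2 _ (ht j hj).1 (hij.trans (ht j hj).2.1)
      ((ht j hj).2.2.1.trans hkj)) ((ht j hj).2.2.2 _ (ht i hi).1 hjt ?_)
    rw [(ht i hi).2.2.1, hkj]
  · refine lt_of_le_of_ne (kanti i hi j hj hij.le) fun h => ?_
    have := (ht i hi).2.2.2 j hj hij.le h
    rw [hti] at this
    exact absurd this hij.not_ge

theorem IsStopping.top_top {F : Finset ι} {lam : ι → ℝ} {k : ι → ℤ} {top : ι → ι}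
    (h : IsStopping F lam k top) {i : ι} (hi : i ∈ F) : top (top i) = top i :=
  h.top_eq i hi _ (h.mem i hi) (h.le i hi) le_rfl

/-- Combinations of a sparse subfamily are almost orthogonal. -/
theorem norm_sq_sum_smul_le (hι : IsForest ι) {u : ι → H} {m : ι → ℝ} (hu : IsForestGram u m)
    (G : Finset ι) (k : ι → ℤ) (hk : ∀ i ∈ G, ∀ j ∈ G, i < j → k j < k i)
    (c : ι → ℝ) (hc : ∀ i ∈ G, |c i| ≤ 2 ^ k i) :
    ‖∑ i ∈ G, c i • u i‖ ^ 2 ≤ 4 * ∑ i ∈ G, (2 ^ k i) ^ 2 * m i := by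
  classical
  have hterm : ∀ i ∈ G, ∑ j ∈ G, (if i ≤ j then (2 : ℝ) ^ k i * 2 ^ k j * m i else 0) ≤
      2 * ((2 ^ k i) ^ 2 * m i) := by
    intro i hi
    rw [← Finset.sum_filter]
    -- Elements above `i` form a chain along which the levels strictly decrease, so the powers are
    -- distinct and bounded by a geometric series.
    have h1 : ∑ j ∈ G.filter (i ≤ ·), (2 : ℝ) ^ k j ≤ 2 * 2 ^ k i := by
      refine sum_two_zpow_comp_le _ k ?_ _ ?_
      · intro a ha b hb hab
        simp only [Finset.coe_filter, Set.mem_ofPred_eq] at ha hb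
        by_contra hne
        rcases hι i a b ha.2 hb.2 with h | h
        · exact absurd hab (hk a ha.1 b hb.1 (lt_of_le_of_ne h hne)).ne'
        · exact absurd hab (hk b hb.1 a ha.1 (lt_of_le_of_ne h (Ne.symm hne))).ne
      · intro j hj
        simp only [Finset.mem_filter] at hj
        rcases hj.2.eq_or_lt with h | h
        · rw [h]
        · exact (hk i hi j hj.1 h).le
    calc ∑ j ∈ G.filter (i ≤ ·), (2 : ℝ) ^ k i * 2 ^ k j * m i
        = 2 ^ k i * m i * ∑ j ∈ G.filter (i ≤ ·), (2 : ℝ) ^ k j := by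
          rw [Finset.mul_sum]; exact Finset.sum_congr rfl fun j _ => by ring
      _ ≤ 2 ^ k i * m i * (2 * 2 ^ k i) := by
          have := hu.nonneg i; gcongr
      _ = _ := by ring
  -- Each pair is charged to the mass of its smaller member; by symmetry this costs a second factor
  -- 2.
  have hpair : ∀ i ∈ G, ∀ j ∈ G, c i * c j * inner ℝ (u i) (u j) ≤
      (if i ≤ j then (2 : ℝ) ^ k i * 2 ^ k j * m i else 0) +
      (if j ≤ i then (2 : ℝ) ^ k j * 2 ^ k i * m j else 0) := by
    intro i hi j hj
    have hcc : c i * c j ≤ 2 ^ k i * 2 ^ k j := by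
      refine (le_abs_self _).trans ?_
      rw [abs_mul]
      exact mul_le_mul (hc i hi) (hc j hj) (abs_nonneg _) (by positivity)
    have h3 : c i * c j * inner ℝ (u i) (u j) ≤ 2 ^ k i * 2 ^ k j * inner ℝ (u i) (u j) :=
      mul_le_mul_of_nonneg_right hcc (hu.inner_nonneg i j)
    have hmi := hu.nonneg i
    have hmj := hu.nonneg j
    have p1 : 0 ≤ (2 : ℝ) ^ k i * 2 ^ k j * m i := by positivity
    have p2 : 0 ≤ (2 : ℝ) ^ k j * 2 ^ k i * m j := by positivity
    refine h3.trans ?_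
    by_cases h1 : i ≤ j
    · rw [hu.inner_of_le i j h1, if_pos h1]
      split_ifs <;> linarith
    · by_cases h2 : j ≤ i
      · rw [real_inner_comm, hu.inner_of_le j i h2, if_neg h1, if_pos h2]
        linarith
      · rw [hu.inner_of_not_le i j h1 h2]
        simp [h1, h2]
  calc ‖∑ i ∈ G, c i • u i‖ ^ 2
      = ∑ i ∈ G, ∑ j ∈ G, c i * c j * inner ℝ (u i) (u j) := by
        rw [← real_inner_self_eq_norm_sq, sum_inner]
        refine Finset.sum_congr rfl fun i _ => ?_
        rw [inner_sum]
        refine Finset.sum_congr rfl fun j _ => ?_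
        rw [real_inner_smul_left, real_inner_smul_right]; ring
    _ ≤ ∑ i ∈ G, ∑ j ∈ G, ((if i ≤ j then (2 : ℝ) ^ k i * 2 ^ k j * m i else 0) +
      (if j ≤ i then (2 : ℝ) ^ k j * 2 ^ k i * m j else 0)) :=
        Finset.sum_le_sum fun i hi => Finset.sum_le_sum fun j hj => hpair i hi j hj
    _ = 2 * ∑ i ∈ G, ∑ j ∈ G, (if i ≤ j then (2 : ℝ) ^ k i * 2 ^ k j * m i else 0) := by
        simp_rw [Finset.sum_add_distrib]
        rw [Finset.sum_comm (f := fun i j => if j ≤ i then (2 : ℝ) ^ k j * 2 ^ k i * m j else 0)]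
        ring
    _ ≤ 2 * ∑ i ∈ G, 2 * ((2 ^ k i) ^ 2 * m i) := by
        gcongr with i hi
        exact hterm i hi
    _ = _ := by rw [← Finset.mul_sum]; ring

/-- A substitute for the maximal theorem. Let X be the left side and g = ∑ ± 2^k u_i with signs
aligned to `f`. Then X ≤ ⟨f, g⟩, while almost orthogonality gives ‖g‖² ≤ 4X. -/
theorem sum_level_sq_le (hι : IsForest ι) {u : ι → H} {m : ι → ℝ} (hu : IsForestGram u m)
    (G : Finset ι) (k : ι → ℤ) (hk : ∀ i ∈ G, ∀ j ∈ G, i < j → k j < k i) (f : H)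
    (hf : ∀ i ∈ G, 2 ^ k i ≤ |inner ℝ f (u i)| / m i) :
    ∑ i ∈ G, (2 ^ k i) ^ 2 * m i ≤ 4 * ‖f‖ ^ 2 := by
  choose ε hε using fun i => exists_sign_mul_eq_abs (inner ℝ f (u i))
  set X := ∑ i ∈ G, ((2 : ℝ) ^ k i) ^ 2 * m i with hX
  have hX0 : 0 ≤ X := Finset.sum_nonneg fun i _ => mul_nonneg (by positivity) (hu.nonneg i)
  have h1 := norm_sq_sum_smul_le hι hu G k hk (fun i => ((ε i : ℤ) : ℝ) * 2 ^ k i) fun i _ => by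
    rw [abs_mul, abs_sign_cast, one_mul, abs_of_pos (by positivity)]
  set g := ∑ i ∈ G, (((ε i : ℤ) : ℝ) * 2 ^ k i) • u i with hg
  have h2 : X ≤ inner ℝ f g := by
    rw [hg, inner_sum]
    refine Finset.sum_le_sum fun i hi => ?_
    rw [inner_smul_right, mul_right_comm, hε, pow_two, mul_assoc, mul_comm]
    refine mul_le_mul_of_nonneg_right ?_ (by positivity)
    rcases (hu.nonneg i).eq_or_lt with h0 | h0
    · rw [← h0]; simp
    · exact (le_div_iff₀ h0).mp (hf i hi)
  have h3 := h2.trans (real_inner_le_norm f g)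
  rcases hX0.eq_or_lt with h0 | h0
  · rw [← h0]; positivity
  · have h4 : X ^ 2 ≤ ‖f‖ ^ 2 * (4 * X) := by
      calc X ^ 2 ≤ (‖f‖ * ‖g‖) ^ 2 := pow_le_pow_left₀ hX0 h3 2
        _ = ‖f‖ ^ 2 * ‖g‖ ^ 2 := by ring
        _ ≤ _ := by gcongr
    nlinarith

theorem IsStopping.sum_level_sq_le (hι : IsForest ι) {u : ι → H} {m : ι → ℝ}
    (hu : IsForestGram u m) {F : Finset ι} {f : H} {k : ι → ℤ} {top : ι → ι}
    (h : IsStopping F (fun i => |inner ℝ f (u i)| / m i) k top) [DecidableEq ι] :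
    ∑ i ∈ F.image top, (2 ^ k i) ^ 2 * m i ≤ 4 * ‖f‖ ^ 2 := by
  refine _root_.sum_level_sq_le hι hu _ k ?_ f ?_
  · intro i hi j hj hij
    obtain ⟨a, ha, rfl⟩ := Finset.mem_image.mp hi
    obtain ⟨b, hb, rfl⟩ := Finset.mem_image.mp hj
    exact h.level_lt _ (h.mem a ha) _ (h.mem b hb) (h.top_top ha) (h.top_top hb) hij
  · intro i hi
    obtain ⟨a, ha, rfl⟩ := Finset.mem_image.mp hi
    exact h.level_le a ha

end Forest

/-! ### Carleson and bilinear embedding theorems -/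

section Embedding

variable {ι H : Type*} [PartialOrder ι] [NormedAddCommGroup H] [InnerProductSpace ℝ H]

open Classical in
-- On the block of elements stopped at t, the average is at most 2 · 2^{k t} and the total of `d` is
-- at most D m(t). What remains is the sum of squared levels over stopping elements; 16 = 2² · 4.
theorem carleson_embedding (hι : IsForest ι) {u : ι → H} {m : ι → ℝ} (hu : IsForestGram u m)
    (F : Finset ι) (d : ι → ℝ) (hd : ∀ i, 0 ≤ d i) {D : ℝ} (hD : 0 ≤ D)
    (hdm : ∀ j, ∑ i ∈ F with i ≤ j, d i ≤ D * m j) (f : H) :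
    ∑ i ∈ F, d i * (|inner ℝ f (u i)| / m i) ^ 2 ≤ 16 * D * ‖f‖ ^ 2 := by
  set lam : ι → ℝ := fun i => |inner ℝ f (u i)| / m i with hlam
  have hlam0 : ∀ i, 0 ≤ lam i := fun i => div_nonneg (abs_nonneg _) (hu.nonneg i)
  -- Logarithmic levels need positive averages; the discarded terms vanish.
  set F' := F.filter (fun i => 0 < lam i) with hF'
  obtain ⟨k, top, h⟩ := exists_isStopping hι F' lam fun i hi => (Finset.mem_filter.mp hi).2
  calc ∑ i ∈ F, d i * lam i ^ 2 = ∑ i ∈ F', d i * lam i ^ 2 := by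
        refine (Finset.sum_filter_of_ne fun i _ hne => ?_).symm
        exact lt_of_le_of_ne (hlam0 i) fun h0 => hne (by rw [← h0]; simp)
    _ ≤ ∑ i ∈ F', d i * (2 * 2 ^ k (top i)) ^ 2 := by
        refine Finset.sum_le_sum fun i hi => ?_
        have := h.le_two_mul i hi
        have := hlam0 i
        have := hd i
        gcongr
    _ = ∑ t ∈ F'.image top, ∑ i ∈ F' with top i = t, d i * (2 * 2 ^ k (top i)) ^ 2 :=
        (Finset.sum_fiberwise_of_maps_to (fun i hi => Finset.mem_image_of_mem _ hi) _).symm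
    _ ≤ ∑ t ∈ F'.image top, 4 * D * ((2 ^ k t) ^ 2 * m t) := by
        refine Finset.sum_le_sum fun t _ => ?_
        calc ∑ i ∈ F' with top i = t, d i * (2 * 2 ^ k (top i)) ^ 2
            = (∑ i ∈ F' with top i = t, d i) * (2 * 2 ^ k t) ^ 2 := by
              rw [Finset.sum_mul]
              exact Finset.sum_congr rfl fun i hi => by rw [(Finset.mem_filter.mp hi).2]
          _ ≤ (∑ i ∈ F with i ≤ t, d i) * (2 * 2 ^ k t) ^ 2 := by
              gcongr ?_ * _
              refine Finset.sum_le_sum_of_subset_of_nonneg (fun i hi => ?_) fun i _ _ => hd i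
              obtain ⟨hi1, rfl⟩ := Finset.mem_filter.mp hi
              exact Finset.mem_filter.mpr ⟨(Finset.mem_filter.mp hi1).1, h.le i hi1⟩
          _ ≤ D * m t * (2 * 2 ^ k t) ^ 2 := by gcongr; exact hdm t
          _ = _ := by ring
    _ = 4 * D * ∑ t ∈ F'.image top, (2 ^ k t) ^ 2 * m t := by rw [Finset.mul_sum]
    _ ≤ 4 * D * (4 * ‖f‖ ^ 2) := by gcongr; exact h.sum_level_sq_le hι hu
    _ = _ := by ring

open Classical in
/-- The half of the bilinear embedding where the second stopping element lies below the first. -/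
theorem bilinear_embedding_half (hι : IsForest ι) {u u' : ι → H} {m m' : ι → ℝ}
    (hu : IsForestGram u m) (hu' : IsForestGram u' m')
    (F : Finset ι) (a : ι → ℝ) (ha : ∀ i, 0 ≤ a i) {K : ℝ} (hK : 0 ≤ K)
    (htest : ∀ j g, ∑ i ∈ F with i ≤ j, a i * (|inner ℝ g (u' i)| / m' i) ≤ K * √(m j) * ‖g‖)
    (f g : H) {k k' : ι → ℤ} {top top' : ι → ι}
    (h : IsStopping F (fun i => |inner ℝ f (u i)| / m i) k top)
    (h' : IsStopping F (fun i => |inner ℝ g (u' i)| / m' i) k' top')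
    (hpos' : ∀ i ∈ F, 0 < |inner ℝ g (u' i)| / m' i) :
    ∑ i ∈ F with top' i ≤ top i,
      a i * (|inner ℝ f (u i)| / m i) * (|inner ℝ g (u' i)| / m' i) ≤ 32 * K * ‖f‖ * ‖g‖ := by
  set lam : ι → ℝ := fun i => |inner ℝ f (u i)| / m i with hlam
  set lam' : ι → ℝ := fun i => |inner ℝ g (u' i)| / m' i with hlam'
  have hlam0' : ∀ i, 0 ≤ lam' i := fun i => div_nonneg (abs_nonneg _) (hu'.nonneg i)
  set E := F.filter (fun i => top' i ≤ top i) with hE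
  have hEF : ∀ i ∈ E, i ∈ F := fun i hi => (Finset.mem_filter.mp hi).1
  -- On the block of `t`, the vector `g` is replaced by `gt t`, built only from those stopping
  -- elements of `g` whose own `f`-stopping element is `t`.
  set 𝒢 : ι → Finset ι := fun t => (F.image top').filter (fun s => top s = t) with h𝒢
  set gt : ι → H := fun t => ∑ s ∈ 𝒢 t, (2 : ℝ) ^ k' s • u' s with hgt
  set P : ι → ℝ := fun t => ∑ s ∈ 𝒢 t, (2 ^ k' s) ^ 2 * m' s with hP
  have hP0 : ∀ t, 0 ≤ P t := fun t =>
    Finset.sum_nonneg fun s _ => mul_nonneg (by positivity) (hu'.nonneg s)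
  have hgtP : ∀ t, ‖gt t‖ ≤ 2 * √(P t) := by
    intro t
    have := norm_sq_sum_smul_le hι hu' (𝒢 t) k' (fun i hi j hj hij => by
      obtain ⟨x, hx, rfl⟩ := Finset.mem_image.mp (Finset.mem_filter.mp hi).1
      obtain ⟨y, hy, rfl⟩ := Finset.mem_image.mp (Finset.mem_filter.mp hj).1
      exact h'.level_lt _ (h'.mem x hx) _ (h'.mem y hy) (h'.top_top hx) (h'.top_top hy) hij)
      (fun s => 2 ^ k' s) fun i _ => (abs_of_pos (by positivity)).le
    refine abs_le_of_sq_le_sq' ?_ (by positivity) |>.2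
    rw [mul_pow, Real.sq_sqrt (hP0 t)]
    linarith
  -- Since `i ≤ top' i ≤ top i`, the element `top' i` belongs to `𝒢 (top i)`, so `gt (top i)`
  -- already carries height `2 ^ k' (top' i)` over `i`.
  have hlamle : ∀ i ∈ E, lam' i ≤ 2 * (|inner ℝ (gt (top i)) (u' i)| / m' i) := by
    intro i hi
    have hiF := hEF i hi
    have hm : 0 < m' i := by
      refine lt_of_le_of_ne (hu'.nonneg i) fun h0 => ?_
      have := hpos' i hiF
      rw [← h0] at this
      simp at this
    have hmem : top' i ∈ 𝒢 (top i) := Finset.mem_filter.mpr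
      ⟨Finset.mem_image_of_mem _ hiF,
        h.top_eq i hiF _ (h'.mem i hiF) (h'.le i hiF) (Finset.mem_filter.mp hi).2⟩
    have h1 : 2 ^ k' (top' i) * m' i ≤ inner ℝ (gt (top i)) (u' i) := by
      rw [hgt, sum_inner]
      refine le_trans (le_of_eq ?_) (Finset.single_le_sum (f := fun s =>
        inner ℝ ((2 : ℝ) ^ k' s • u' s) (u' i)) (fun s _ => ?_) hmem)
      · rw [real_inner_smul_left, real_inner_comm, hu'.inner_of_le i _ (h'.le i hiF)]
      · rw [real_inner_smul_left]
        exact mul_nonneg (by positivity) (hu'.inner_nonneg _ _)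
    refine (h'.le_two_mul i hiF).trans ?_
    gcongr
    rw [le_div_iff₀ hm]
    exact h1.trans (le_abs_self _)
  have hblock : ∀ t, ∑ i ∈ E with top i = t, a i * lam i * lam' i ≤
      8 * K * ((2 ^ k t * √(m t)) * √(P t)) := by
    intro t
    calc ∑ i ∈ E with top i = t, a i * lam i * lam' i
        ≤ ∑ i ∈ E with top i = t, 4 * 2 ^ k t * (a i * (|inner ℝ (gt t) (u' i)| / m' i)) := by
          refine Finset.sum_le_sum fun i hi => ?_
          obtain ⟨hiE, rfl⟩ := Finset.mem_filter.mp hi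
          have h1 := h.le_two_mul i (hEF i hiE)
          have h2 := hlamle i hiE
          calc a i * lam i * lam' i ≤ a i * (2 * 2 ^ k (top i)) *
                (2 * (|inner ℝ (gt (top i)) (u' i)| / m' i)) := by
                have := ha i
                have := hlam0' i
                gcongr
            _ = _ := by ring
      _ = 4 * 2 ^ k t * ∑ i ∈ E with top i = t, a i * (|inner ℝ (gt t) (u' i)| / m' i) := by
          rw [Finset.mul_sum]
      _ ≤ 4 * 2 ^ k t * ∑ i ∈ F with i ≤ t, a i * (|inner ℝ (gt t) (u' i)| / m' i) := by
          refine mul_le_mul_of_nonneg_left (Finset.sum_le_sum_of_subset_of_nonneg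
            (fun i hi => ?_) fun i _ _ =>
              mul_nonneg (ha i) (div_nonneg (abs_nonneg _) (hu'.nonneg i))) (by positivity)
          obtain ⟨hiE, rfl⟩ := Finset.mem_filter.mp hi
          exact Finset.mem_filter.mpr ⟨hEF i hiE, h.le i (hEF i hiE)⟩
      _ ≤ 4 * 2 ^ k t * (K * √(m t) * (2 * √(P t))) := by
          gcongr
          exact (htest t (gt t)).trans (by gcongr; exact hgtP t)
      _ = _ := by ring
  have hsum1 : ∑ t ∈ F.image top, (2 ^ k t * √(m t)) ^ 2 ≤ (2 * ‖f‖) ^ 2 := by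
    calc ∑ t ∈ F.image top, (2 ^ k t * √(m t)) ^ 2 = ∑ t ∈ F.image top, (2 ^ k t) ^ 2 * m t :=
          Finset.sum_congr rfl fun t _ => by rw [mul_pow, Real.sq_sqrt (hu.nonneg t)]
      _ ≤ 4 * ‖f‖ ^ 2 := h.sum_level_sq_le hι hu
      _ = _ := by ring
  -- The families `𝒢 t` partition the stopping elements of `g`, so the localized pieces add up
  -- without overlap.
  have hsum2 : ∑ t ∈ F.image top, √(P t) ^ 2 ≤ (2 * ‖g‖) ^ 2 := by
    calc ∑ t ∈ F.image top, √(P t) ^ 2 = ∑ t ∈ F.image top, P t :=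
          Finset.sum_congr rfl fun t _ => Real.sq_sqrt (hP0 t)
      _ = ∑ s ∈ F.image top', (2 ^ k' s) ^ 2 * m' s := by
          refine Finset.sum_fiberwise_of_maps_to (fun s hs => ?_) _
          obtain ⟨x, hx, rfl⟩ := Finset.mem_image.mp hs
          exact Finset.mem_image_of_mem _ (h'.mem x hx)
      _ ≤ 4 * ‖g‖ ^ 2 := h'.sum_level_sq_le hι hu'
      _ = _ := by ring
  calc ∑ i ∈ E, a i * lam i * lam' i
      = ∑ t ∈ F.image top, ∑ i ∈ E with top i = t, a i * lam i * lam' i :=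
        (Finset.sum_fiberwise_of_maps_to
          (fun i hi => Finset.mem_image_of_mem _ (hEF i hi)) _).symm
    _ ≤ ∑ t ∈ F.image top, 8 * K * ((2 ^ k t * √(m t)) * √(P t)) :=
        Finset.sum_le_sum fun t _ => hblock t
    _ = 8 * K * ∑ t ∈ F.image top, (2 ^ k t * √(m t)) * √(P t) := by rw [Finset.mul_sum]
    _ ≤ 8 * K * (√((2 * ‖f‖) ^ 2) * √((2 * ‖g‖) ^ 2)) := by
        gcongr
        exact (Real.sum_mul_le_sqrt_mul_sqrt _ _ _).trans (by gcongr)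
    _ = _ := by
        rw [Real.sqrt_sq (by positivity), Real.sqrt_sq (by positivity)]; ring

open Classical in
/-- The two-weight bilinear embedding theorem for positive dyadic forms. -/
theorem bilinear_embedding (hι : IsForest ι) {u u' : ι → H} {m m' : ι → ℝ}
    (hu : IsForestGram u m) (hu' : IsForestGram u' m')
    (F : Finset ι) (a : ι → ℝ) (ha : ∀ i, 0 ≤ a i) {K : ℝ} (hK : 0 ≤ K)
    (htest : ∀ j g, ∑ i ∈ F with i ≤ j, a i * (|inner ℝ g (u' i)| / m' i) ≤ K * √(m j) * ‖g‖)
    (htest' : ∀ j f, ∑ i ∈ F with i ≤ j, a i * (|inner ℝ f (u i)| / m i) ≤ K * √(m' j) * ‖f‖)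
    (f g : H) :
    ∑ i ∈ F, a i * (|inner ℝ f (u i)| / m i) * (|inner ℝ g (u' i)| / m' i) ≤
      64 * K * ‖f‖ * ‖g‖ := by
  set lam : ι → ℝ := fun i => |inner ℝ f (u i)| / m i with hlam
  set lam' : ι → ℝ := fun i => |inner ℝ g (u' i)| / m' i with hlam'
  have hlam0 : ∀ i, 0 ≤ lam i := fun i => div_nonneg (abs_nonneg _) (hu.nonneg i)
  have hlam0' : ∀ i, 0 ≤ lam' i := fun i => div_nonneg (abs_nonneg _) (hu'.nonneg i)
  set F' := F.filter (fun i => 0 < lam i ∧ 0 < lam' i) with hF'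
  have hpos : ∀ i ∈ F', 0 < lam i := fun i hi => (Finset.mem_filter.mp hi).2.1
  have hpos' : ∀ i ∈ F', 0 < lam' i := fun i hi => (Finset.mem_filter.mp hi).2.2
  obtain ⟨k, top, h⟩ := exists_isStopping hι F' lam hpos
  obtain ⟨k', top', h'⟩ := exists_isStopping hι F' lam' hpos'
  have hmono : ∀ (c : ι → ℝ), (∀ i, 0 ≤ c i) → ∀ j,
      ∑ i ∈ F' with i ≤ j, a i * c i ≤ ∑ i ∈ F with i ≤ j, a i * c i := fun c hc j =>
    Finset.sum_le_sum_of_subset_of_nonneg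
      (Finset.filter_subset_filter _ (Finset.filter_subset _ _))
      fun i _ _ => mul_nonneg (ha i) (hc i)
  have h1 := bilinear_embedding_half hι hu hu' F' a ha hK (fun j g' =>
    (hmono _ (fun i => div_nonneg (abs_nonneg _) (hu'.nonneg i)) j).trans (htest j g')) f g h h' hpos'
  have h2 := bilinear_embedding_half hι hu' hu F' a ha hK (fun j f' =>
    (hmono _ (fun i => div_nonneg (abs_nonneg _) (hu.nonneg i)) j).trans (htest' j f')) g f h' h hpos
  have hnn : ∀ i, 0 ≤ a i * lam i * lam' i := fun i =>
    mul_nonneg (mul_nonneg (ha i) (hlam0 i)) (hlam0' i)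
  calc ∑ i ∈ F, a i * lam i * lam' i = ∑ i ∈ F', a i * lam i * lam' i := by
        refine (Finset.sum_filter_of_ne fun i _ hne => ?_).symm
        exact ⟨lt_of_le_of_ne (hlam0 i) fun h0 => hne (by rw [← h0]; simp),
          lt_of_le_of_ne (hlam0' i) fun h0 => hne (by rw [← h0]; simp)⟩
    _ = ∑ i ∈ F' with top' i ≤ top i, a i * lam i * lam' i +
        ∑ i ∈ F' with ¬ top' i ≤ top i, a i * lam i * lam' i :=
        (Finset.sum_filter_add_sum_filter_not _ _ _).symm
    -- Both stopping elements lie above `i`, hence are comparable; the remaining case has the roles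
    -- of `f` and `g` exchanged.
    _ ≤ ∑ i ∈ F' with top' i ≤ top i, a i * lam i * lam' i +
        ∑ i ∈ F' with top i ≤ top' i, a i * lam' i * lam i := by
        refine add_le_add le_rfl ?_
        rw [Finset.sum_congr rfl fun i (_ : i ∈ F'.filter fun i => top i ≤ top' i) =>
          mul_right_comm (a i) (lam' i) (lam i)]
        refine Finset.sum_le_sum_of_subset_of_nonneg (fun i hi => ?_) fun i _ _ => hnn i
        obtain ⟨hi, hn⟩ := Finset.mem_filter.mp hi
        exact Finset.mem_filter.mpr
          ⟨hi, (hι i _ _ (h.le i hi) (h'.le i hi)).resolve_right hn⟩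
    _ ≤ 32 * K * ‖f‖ * ‖g‖ + 32 * K * ‖g‖ * ‖f‖ := add_le_add h1 h2
    _ = _ := by ring

end Embedding

/-! ### Weighted Haar functions and the four-piece splitting -/

section HaarGram

variable {ι H : Type*} [PartialOrder ι] [NormedAddCommGroup H] [InnerProductSpace ℝ H]

/-- The vectors `u i`, `x i` have the inner products, with respect to some measure, of the
indicator functions and of the Haar functions of a forest of sets of lengths `ℓ i`. -/
structure IsHaarGram (u x : ι → H) (m ℓ : ι → ℝ) : Prop extends IsForestGram u m where
  exists_const : ∀ i j, i < j → ∃ c : ℝ,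
    inner ℝ (x i) (x j) = c * inner ℝ (x i) (u i) ∧ inner ℝ (u i) (x j) = c * m i
  inner_indicator : ∀ i j, i ≤ j → inner ℝ (x i) (u j) = inner ℝ (x i) (u i)
  inner_haar_of_not_le : ∀ i j, ¬ i ≤ j → ¬ j ≤ i → inner ℝ (x i) (x j) = 0
  inner_indicator_of_not_le : ∀ i j, ¬ i ≤ j → ¬ j ≤ i → inner ℝ (x i) (u j) = 0
  norm_haar_sq : ∀ i, ‖x i‖ ^ 2 = m i / ℓ i

/-- The part of `x i` orthogonal to `u i`: an unnormalized weighted Haar function. -/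
noncomputable def orthHaar (u x : ι → H) (m : ι → ℝ) (i : ι) : H :=
  x i - (inner ℝ (x i) (u i) / m i) • u i

namespace IsHaarGram

variable {u x : ι → H} {m ℓ : ι → ℝ}

/-- Division by `m i = 0` is harmless, because then `u i = 0`. -/
theorem coeff_mul (h : IsHaarGram u x m ℓ) (i : ι) :
    inner ℝ (x i) (u i) / m i * m i = inner ℝ (x i) (u i) := by
  by_cases hm : m i = 0
  · have : u i = 0 := by
      rw [← norm_eq_zero, ← sq_eq_zero_iff, h.norm_sq, hm]
    rw [this]; simp
  · exact div_mul_cancel₀ _ hm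

theorem orthHaar_inner_indicator (h : IsHaarGram u x m ℓ) (i : ι) :
    inner ℝ (orthHaar u x m i) (u i) = 0 := by
  rw [orthHaar, inner_sub_left, real_inner_smul_left, h.inner_of_le i i le_rfl, h.coeff_mul, sub_self]

theorem norm_orthHaar_sq_le (h : IsHaarGram u x m ℓ) (i : ι) :
    ‖orthHaar u x m i‖ ^ 2 ≤ m i / ℓ i := by
  have h2 : ‖x i‖ ^ 2 = ‖orthHaar u x m i‖ ^ 2 +
      ‖(inner ℝ (x i) (u i) / m i) • u i‖ ^ 2 := by
    have hx : x i = orthHaar u x m i + (inner ℝ (x i) (u i) / m i) • u i :=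
      (sub_add_cancel _ _).symm
    conv_lhs => rw [hx]
    rw [norm_add_sq_real, real_inner_smul_right, h.orthHaar_inner_indicator]
    ring
  rw [← h.norm_haar_sq, h2]
  linarith [sq_nonneg ‖(inner ℝ (x i) (u i) / m i) • u i‖]

theorem orthHaar_eq_zero (h : IsHaarGram u x m ℓ) {i : ι} (hm : m i = 0) :
    orthHaar u x m i = 0 := by
  have := h.norm_orthHaar_sq_le i
  rw [hm, zero_div] at this
  exact norm_eq_zero.mp (pow_eq_zero_iff two_ne_zero |>.mp (le_antisymm this (sq_nonneg _)))

/-- Over the smaller set `i`, both `x j` and `u j` act as multiples of `u i`, and the weighted Haar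
vector of `i` is orthogonal to `u i`. -/
theorem orthHaar_inner_of_lt (h : IsHaarGram u x m ℓ) {i j : ι} (hij : i < j) :
    inner ℝ (orthHaar u x m i) (orthHaar u x m j) = 0 := by
  obtain ⟨c, h1, h2⟩ := h.exists_const i j hij
  have hu : inner ℝ (orthHaar u x m i) (u j) = 0 := by
    rw [orthHaar, inner_sub_left, real_inner_smul_left, h.inner_of_le i j hij.le,
      h.inner_indicator i j hij.le, h.coeff_mul, sub_self]
  have hx : inner ℝ (orthHaar u x m i) (x j) = 0 := by
    rw [orthHaar, inner_sub_left, real_inner_smul_left, h1, h2]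
    linear_combination -c * h.coeff_mul i
  conv_lhs => rw [orthHaar.eq_def u x m j]
  rw [inner_sub_right, real_inner_smul_right, hu, hx]
  simp

theorem orthHaar_inner_of_ne (h : IsHaarGram u x m ℓ) {i j : ι} (hij : i ≠ j) :
    inner ℝ (orthHaar u x m i) (orthHaar u x m j) = 0 := by
  by_cases h1 : i ≤ j
  · exact h.orthHaar_inner_of_lt (lt_of_le_of_ne h1 hij)
  · by_cases h2 : j ≤ i
    · rw [real_inner_comm]
      exact h.orthHaar_inner_of_lt (lt_of_le_of_ne h2 hij.symm)
    · have e1 := h.inner_haar_of_not_le i j h1 h2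
      have e2 := h.inner_indicator_of_not_le i j h1 h2
      have e3 := h.inner_indicator_of_not_le j i h2 h1
      have e4 := h.inner_of_not_le i j h1 h2
      rw [real_inner_comm] at e3
      simp [orthHaar, inner_sub_left, inner_sub_right, real_inner_smul_left,
        real_inner_smul_right, e1, e2, e3, e4]

/-- Bessel's inequality for the weighted Haar functions. -/
theorem bessel (h : IsHaarGram u x m ℓ) (hℓ : ∀ i, 0 < ℓ i) (F : Finset ι) (f : H) :
    ∑ i ∈ F, inner ℝ f (orthHaar u x m i) ^ 2 * (ℓ i / m i) ≤ ‖f‖ ^ 2 := by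
  classical
  set κ := orthHaar u x m with hκ
  set S := ∑ i ∈ F, inner ℝ f (κ i) ^ 2 * (ℓ i / m i) with hS
  -- A damped projection: `(ℓ i / m i) * ‖κ i‖ ^ 2` is at most 1, so ‖p‖² ≤ ⟨f, p⟩ = S, and
  -- expanding ‖f - p‖² ≥ 0 gives S ≤ ‖f‖².
  set p := ∑ i ∈ F, (inner ℝ f (κ i) * (ℓ i / m i)) • κ i with hp
  have h1 : inner ℝ f p = S := by
    rw [hp, inner_sum]
    exact Finset.sum_congr rfl fun i _ => by rw [real_inner_smul_right]; ring
  have h2 : ‖p‖ ^ 2 ≤ S := by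
    rw [← real_inner_self_eq_norm_sq]
    nth_rw 1 [hp]
    rw [sum_inner]
    refine Finset.sum_le_sum fun i hi => ?_
    rw [hp, inner_sum, Finset.sum_eq_single_of_mem i hi fun j _ hji => by
      rw [real_inner_smul_left, real_inner_smul_right, h.orthHaar_inner_of_ne hji.symm]; simp]
    rw [real_inner_smul_left, real_inner_smul_right, real_inner_self_eq_norm_sq]
    rcases (h.nonneg i).eq_or_lt with h0 | h0
    · simp [← h0]
    · have hk := h.norm_orthHaar_sq_le i
      have hl := hℓ i
      calc inner ℝ f (κ i) * (ℓ i / m i) * (inner ℝ f (κ i) * (ℓ i / m i) * ‖κ i‖ ^ 2)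
          = inner ℝ f (κ i) ^ 2 * (ℓ i / m i) * ((ℓ i / m i) * ‖κ i‖ ^ 2) := by ring
        _ ≤ inner ℝ f (κ i) ^ 2 * (ℓ i / m i) * ((ℓ i / m i) * (m i / ℓ i)) := by gcongr
        _ = _ := by field_simp
  have h3 := norm_sub_sq_real f p
  have h4 := sq_nonneg ‖f - p‖
  linarith

theorem sum_mul_abs_inner_le (h : IsHaarGram u x m ℓ) (hℓ : ∀ i, 0 < ℓ i) (F : Finset ι)
    (b : ι → ℝ) (g : H) {B : ℝ} (hB : ∑ i ∈ F, b i ^ 2 * (m i / ℓ i) ≤ B ^ 2)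
    (hB0 : 0 ≤ B) :
    ∑ i ∈ F, b i * |inner ℝ g (orthHaar u x m i)| ≤ B * ‖g‖ := by
  calc ∑ i ∈ F, b i * |inner ℝ g (orthHaar u x m i)|
      = ∑ i ∈ F, (b i * √(m i / ℓ i)) * (|inner ℝ g (orthHaar u x m i)| * √(ℓ i / m i)) := by
        refine Finset.sum_congr rfl fun i _ => ?_
        rcases (h.nonneg i).eq_or_lt with h0 | h0
        · rw [h.orthHaar_eq_zero h0.symm]; simp
        · have hl := hℓ i
          have : √(m i / ℓ i) * √(ℓ i / m i) = 1 := by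
            rw [← Real.sqrt_mul (by positivity), show m i / ℓ i * (ℓ i / m i) = 1 by field_simp,
              Real.sqrt_one]
          linear_combination (-(b i) * |inner ℝ g (orthHaar u x m i)|) * this
    _ ≤ √(∑ i ∈ F, (b i * √(m i / ℓ i)) ^ 2) *
        √(∑ i ∈ F, (|inner ℝ g (orthHaar u x m i)| * √(ℓ i / m i)) ^ 2) :=
        Real.sum_mul_le_sqrt_mul_sqrt _ _ _
    _ ≤ √(B ^ 2) * √(‖g‖ ^ 2) := by
        gcongr
        · refine le_trans (le_of_eq (Finset.sum_congr rfl fun i _ => ?_)) hB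
          rw [mul_pow, Real.sq_sqrt (div_nonneg (h.nonneg i) (hℓ i).le)]
        · refine le_trans (le_of_eq (Finset.sum_congr rfl fun i _ => ?_)) (h.bessel hℓ F g)
          rw [mul_pow, Real.sq_sqrt (div_nonneg (hℓ i).le (h.nonneg i)), sq_abs]
    _ = B * ‖g‖ := by rw [Real.sqrt_sq hB0, Real.sqrt_sq (norm_nonneg _)]

theorem abs_inner_haar_le (h : IsHaarGram u x m ℓ) (f : H) (i : ι) :
    |inner ℝ f (x i)| ≤ |inner ℝ f (orthHaar u x m i)| +
      |inner ℝ (x i) (u i)| * (|inner ℝ f (u i)| / m i) := by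
  have : inner ℝ f (x i) = inner ℝ f (orthHaar u x m i) +
      inner ℝ (x i) (u i) * (inner ℝ f (u i) / m i) := by
    rw [orthHaar, inner_sub_right, real_inner_smul_right]; ring
  rw [this]
  refine (abs_add_le _ _).trans (le_of_eq ?_)
  rw [abs_mul, abs_div, abs_of_nonneg (h.nonneg i)]

theorem abs_inner_orthHaar_le (h : IsHaarGram u x m ℓ) (f : H) (i : ι) :
    |inner ℝ (x i) (u i)| * (|inner ℝ f (u i)| / m i) ≤
      |inner ℝ f (x i)| + |inner ℝ f (orthHaar u x m i)| := by
  have : inner ℝ (x i) (u i) * (inner ℝ f (u i) / m i) =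
      inner ℝ f (x i) - inner ℝ f (orthHaar u x m i) := by
    rw [orthHaar, inner_sub_right, real_inner_smul_right]; ring
  have h2 := abs_sub (inner ℝ f (x i)) (inner ℝ f (orthHaar u x m i))
  rw [← this, abs_mul, abs_div, abs_of_nonneg (h.nonneg i)] at h2
  exact h2

variable {u' x' : ι → H} {m' : ι → ℝ}

open Classical in
-- Testing bounds all signed sums of the vectors `c i • x' i` with `i ≤ j`, hence, for well-chosen
-- signs, the sum of their squared norms.
theorem carleson_of_testing (h' : IsHaarGram u' x' m' ℓ) (c : ι → ℝ) (F : Finset ι) {K : ℝ}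
    (hK : 0 ≤ K) (hm : ∀ i, 0 ≤ m i)
    (htest : ∀ j φ, ∑ i ∈ F with i ≤ j, |c i| * |inner ℝ φ (x' i)| ≤ K * √(m j) * ‖φ‖)
    (j : ι) : ∑ i ∈ F with i ≤ j, c i ^ 2 * (m' i / ℓ i) ≤ K ^ 2 * m j := by
  have := sum_norm_sq_le_of_sum_abs_inner_le (fun i => c i • x' i)
    (show 0 ≤ K * √(m j) by positivity) (F.filter (· ≤ j)) fun φ => by
      simpa [inner_smul_right, abs_mul] using htest j φ
  simpa [norm_smul, mul_pow, h'.norm_haar_sq, Real.sq_sqrt (hm j)] using this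

open Classical in
/-- Testing and the `A₂` condition imply the bilinear bound. -/
theorem absBilinearBound (hι : IsForest ι) (h : IsHaarGram u x m ℓ) (h' : IsHaarGram u' x' m' ℓ)
    (hℓ : ∀ i, 0 < ℓ i) {K B : ℝ} (hK : 0 ≤ K) (hB : 0 ≤ B)
    (hA2 : ∀ i, m i * m' i ≤ (B * ℓ i) ^ 2)
    (htest : ∀ (F : Finset ι) j φ, ∑ i ∈ F with i ≤ j,
      |inner ℝ (x i) (u i)| * |inner ℝ φ (x' i)| ≤ K * √(m j) * ‖φ‖)
    (htest' : ∀ (F : Finset ι) j φ, ∑ i ∈ F with i ≤ j,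
      |inner ℝ (x' i) (u' i)| * |inner ℝ φ (x i)| ≤ K * √(m' j) * ‖φ‖) :
    AbsBilinearBound x x' (B + 136 * K) := by
  intro F f g
  set c : ι → ℝ := fun i => inner ℝ (x i) (u i) with hc
  set c' : ι → ℝ := fun i => inner ℝ (x' i) (u' i) with hc'
  set lam : ι → ℝ := fun i => |inner ℝ f (u i)| / m i with hlam
  set lam' : ι → ℝ := fun i => |inner ℝ g (u' i)| / m' i with hlam'
  have hd := h'.carleson_of_testing c F hK h.nonneg (htest F)
  have hd' := h.carleson_of_testing c' F hK h'.nonneg (htest' F)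
  -- Cauchy–Schwarz and Bessel for both weights; the product bound `hA2` converts one normalization
  -- into the other.
  have S1 : ∑ i ∈ F, |inner ℝ f (orthHaar u x m i)| * |inner ℝ g (orthHaar u' x' m' i)| ≤
      B * ‖f‖ * ‖g‖ := by
    refine h'.sum_mul_abs_inner_le hℓ F _ g ?_ (by positivity)
    calc ∑ i ∈ F, |inner ℝ f (orthHaar u x m i)| ^ 2 * (m' i / ℓ i)
        ≤ ∑ i ∈ F, B ^ 2 * (inner ℝ f (orthHaar u x m i) ^ 2 * (ℓ i / m i)) := by
          refine Finset.sum_le_sum fun i _ => ?_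
          rw [sq_abs]
          rcases (h.nonneg i).eq_or_lt with h0 | h0
          · rw [h.orthHaar_eq_zero h0.symm]; simp
          · have hl := hℓ i
            have : m' i / ℓ i ≤ B ^ 2 * (ℓ i / m i) := by
              rw [div_le_iff₀ hl, mul_div_assoc', div_mul_eq_mul_div, le_div_iff₀ h0]
              linarith [hA2 i]
            calc _ ≤ inner ℝ f (orthHaar u x m i) ^ 2 * (B ^ 2 * (ℓ i / m i)) := by gcongr
              _ = _ := by ring
      _ = B ^ 2 * ∑ i ∈ F, inner ℝ f (orthHaar u x m i) ^ 2 * (ℓ i / m i) := by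
          rw [Finset.mul_sum]
      _ ≤ B ^ 2 * ‖f‖ ^ 2 := by gcongr; exact h.bessel hℓ F f
      _ = _ := by ring
  have S2 : ∑ i ∈ F, |c i| * lam i * |inner ℝ g (orthHaar u' x' m' i)| ≤ 4 * K * ‖f‖ * ‖g‖ := by
    refine h'.sum_mul_abs_inner_le hℓ F _ g ?_ (by positivity)
    have := carleson_embedding hι h.toIsForestGram F (fun i => c i ^ 2 * (m' i / ℓ i))
      (fun i => mul_nonneg (sq_nonneg _) (div_nonneg (h'.nonneg i) (hℓ i).le)) (sq_nonneg K) hd f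
    calc _ = ∑ i ∈ F, c i ^ 2 * (m' i / ℓ i) * lam i ^ 2 :=
          Finset.sum_congr rfl fun i _ => by rw [mul_pow, sq_abs]; ring
      _ ≤ _ := this
      _ = _ := by ring
  have S3 : ∑ i ∈ F, |c' i| * lam' i * |inner ℝ f (orthHaar u x m i)| ≤ 4 * K * ‖g‖ * ‖f‖ := by
    refine h.sum_mul_abs_inner_le hℓ F _ f ?_ (by positivity)
    have := carleson_embedding hι h'.toIsForestGram F (fun i => c' i ^ 2 * (m i / ℓ i))
      (fun i => mul_nonneg (sq_nonneg _) (div_nonneg (h.nonneg i) (hℓ i).le)) (sq_nonneg K) hd' g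
    calc _ = ∑ i ∈ F, c' i ^ 2 * (m i / ℓ i) * lam' i ^ 2 :=
          Finset.sum_congr rfl fun i _ => by rw [mul_pow, sq_abs]; ring
      _ ≤ _ := this
      _ = _ := by ring
  -- Testing in `bilinear_embedding` concerns averages, whereas `htest` concerns `x'`. Their
  -- difference is an orthogonal Haar term, bounded by Bessel and the Carleson condition; hence 2K,
  -- and 136 = 4 + 4 + 64 · 2.
  have S4 : ∑ i ∈ F, |c i| * |c' i| * lam i * lam' i ≤ 64 * (2 * K) * ‖f‖ * ‖g‖ := by
    refine bilinear_embedding hι h.toIsForestGram h'.toIsForestGram F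
      (fun i => |c i| * |c' i|) (fun i => by positivity) (by positivity)
      (fun j ψ => ?_) (fun j ψ => ?_) f g
    · have e := h'.sum_mul_abs_inner_le hℓ (F.filter (· ≤ j)) (fun i => |c i|) ψ
        (B := K * √(m j)) (by
          simpa [mul_pow, Real.sq_sqrt (h.nonneg j)] using hd j)
        (by positivity)
      have e2 := htest F j ψ
      calc _ ≤ ∑ i ∈ F with i ≤ j, (|c i| * |inner ℝ ψ (x' i)| +
            |c i| * |inner ℝ ψ (orthHaar u' x' m' i)|) := by
            refine Finset.sum_le_sum fun i _ => ?_
            rw [mul_assoc, ← mul_add]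
            gcongr
            exact h'.abs_inner_orthHaar_le ψ i
        _ ≤ _ := by rw [Finset.sum_add_distrib]; linarith
    · have e := h.sum_mul_abs_inner_le hℓ (F.filter (· ≤ j)) (fun i => |c' i|) ψ
        (B := K * √(m' j)) (by
          simpa [mul_pow, Real.sq_sqrt (h'.nonneg j)] using hd' j)
        (by positivity)
      have e2 := htest' F j ψ
      calc _ ≤ ∑ i ∈ F with i ≤ j, (|c' i| * |inner ℝ ψ (x i)| +
            |c' i| * |inner ℝ ψ (orthHaar u x m i)|) := by
            refine Finset.sum_le_sum fun i _ => ?_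
            rw [mul_comm |c i|, mul_assoc, ← mul_add]
            gcongr
            exact h.abs_inner_orthHaar_le ψ i
        _ ≤ _ := by rw [Finset.sum_add_distrib]; linarith
  calc ∑ i ∈ F, |inner ℝ f (x i)| * |inner ℝ g (x' i)|
      ≤ ∑ i ∈ F, ((|inner ℝ f (orthHaar u x m i)| * |inner ℝ g (orthHaar u' x' m' i)| +
          |c i| * lam i * |inner ℝ g (orthHaar u' x' m' i)|) +
          (|c' i| * lam' i * |inner ℝ f (orthHaar u x m i)| +
          |c i| * |c' i| * lam i * lam' i)) := by
        refine Finset.sum_le_sum fun i _ => ?_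
        have e1 := h.abs_inner_haar_le f i
        have e2 := h'.abs_inner_haar_le g i
        refine (mul_le_mul e1 e2 (abs_nonneg _) ((abs_nonneg _).trans e1)).trans (le_of_eq ?_)
        ring
    _ ≤ (B + 136 * K) * ‖f‖ * ‖g‖ := by
        rw [Finset.sum_add_distrib, Finset.sum_add_distrib, Finset.sum_add_distrib]
        linarith

end IsHaarGram

end HaarGram

/-! ### Geometry of dyadic intervals and Haar functions -/

namespace DyadicInterval

theorem length_pos (I : DyadicInterval) : 0 < I.length := zpow_pos two_pos _

theorem mem_Ico_mul_iff {d x : ℝ} (hd : 0 < d) (k : ℤ) :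
    x ∈ Set.Ico ((k : ℝ) * d) (((k : ℝ) + 1) * d) ↔ ⌊x / d⌋ = k := by
  rw [Int.floor_eq_iff, Set.mem_Ico, le_div_iff₀ hd, div_lt_iff₀ hd]

theorem mem_toSet_iff (I : DyadicInterval) (x : ℝ) : x ∈ I.toSet ↔ ⌊x / I.length⌋ = I.index :=
  mem_Ico_mul_iff I.length_pos _

theorem mem_leftHalf_iff (I : DyadicInterval) (x : ℝ) :
    x ∈ I.leftHalf ↔ ⌊x / (I.length / 2)⌋ = 2 * I.index := by
  rw [← mem_Ico_mul_iff (half_pos I.length_pos)]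
  have e1 : ((2 * I.index : ℤ) : ℝ) * (I.length / 2) = I.index * I.length := by push_cast; ring
  have e2 : (((2 * I.index : ℤ) : ℝ) + 1) * (I.length / 2) = (I.index + 1 / 2) * I.length := by
    push_cast; ring
  rw [e1, e2, leftHalf]

theorem mem_rightHalf_iff (I : DyadicInterval) (x : ℝ) :
    x ∈ I.rightHalf ↔ ⌊x / (I.length / 2)⌋ = 2 * I.index + 1 := by
  rw [← mem_Ico_mul_iff (half_pos I.length_pos)]
  have e1 : ((2 * I.index + 1 : ℤ) : ℝ) * (I.length / 2) = (I.index + 1 / 2) * I.length := by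
    push_cast; ring
  have e2 : (((2 * I.index + 1 : ℤ) : ℝ) + 1) * (I.length / 2) = (I.index + 1) * I.length := by
    push_cast; ring
  rw [e1, e2, rightHalf]

/-- The floor at a coarser scale is an integer quotient of the floor at a finer one. All nesting
properties rest on this. -/
theorem floor_div_zpow_congr {s r : ℤ} (hsr : s ≤ r) {x y : ℝ}
    (h : ⌊x / (2 : ℝ) ^ s⌋ = ⌊y / (2 : ℝ) ^ s⌋) : ⌊x / (2 : ℝ) ^ r⌋ = ⌊y / (2 : ℝ) ^ r⌋ := by
  obtain ⟨n, rfl⟩ := Int.le.dest hsr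
  have e : ∀ z : ℝ, ⌊z / (2 : ℝ) ^ (s + n)⌋ = ⌊z / (2 : ℝ) ^ s⌋ / ((2 ^ n : ℕ) : ℤ) := fun z => by
    rw [← Int.floor_div_natCast, zpow_add₀ two_ne_zero, div_div]
    norm_cast
  rw [e, e, h]

theorem left_mem_toSet (I : DyadicInterval) : (I.index : ℝ) * I.length ∈ I.toSet := by
  have := I.length_pos
  constructor
  · exact le_rfl
  · nlinarith

theorem half_length (I : DyadicInterval) : I.length / 2 = (2 : ℝ) ^ (I.scale - 1) := by
  rw [length, zpow_sub_one₀ two_ne_zero, div_eq_mul_inv]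

theorem disjoint_leftHalf_rightHalf (I : DyadicInterval) : Disjoint I.leftHalf I.rightHalf := by
  rw [Set.disjoint_left]
  intro x h1 h2
  rw [mem_leftHalf_iff] at h1
  rw [mem_rightHalf_iff] at h2
  omega

theorem mem_toSet_iff_half (I : DyadicInterval) (x : ℝ) :
    x ∈ I.toSet ↔ x ∈ I.leftHalf ∨ x ∈ I.rightHalf := by
  have h2 : ⌊x / I.length⌋ = ⌊x / (I.length / 2)⌋ / 2 := by
    have := Int.floor_div_natCast (x / (I.length / 2)) 2
    rw [← Nat.cast_ofNat (R := ℤ), ← this]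
    congr 1
    have := I.length_pos
    push_cast
    field_simp
  rw [mem_toSet_iff, mem_leftHalf_iff, mem_rightHalf_iff, h2]
  omega

theorem subset_or_disjoint {I J : DyadicInterval} (h : I.scale ≤ J.scale) :
    I.toSet ⊆ J.toSet ∨ Disjoint I.toSet J.toSet := by
  by_cases hd : Disjoint I.toSet J.toSet
  · exact Or.inr hd
  · obtain ⟨y, hyI, hyJ⟩ := Set.not_disjoint_iff.mp hd
    refine Or.inl fun x hx => ?_
    rw [mem_toSet_iff] at *
    rw [← hyJ]
    exact floor_div_zpow_congr h (hx.trans hyI.symm)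

theorem toSet_subset_iff_scale {I J : DyadicInterval} (h : I.toSet ⊆ J.toSet) :
    I.scale ≤ J.scale := by
  have hI := I.length_pos
  have := (Set.Ico_subset_Ico_iff (show (I.index : ℝ) * I.length < (I.index + 1) * I.length by
    nlinarith)).mp h
  have h2 : I.length ≤ J.length := by nlinarith
  exact (zpow_le_zpow_iff_right₀ (by norm_num)).mp h2

theorem toSet_injective : Function.Injective toSet := by
  intro I J h
  have hs : I.scale = J.scale :=
    le_antisymm (toSet_subset_iff_scale h.subset) (toSet_subset_iff_scale h.superset)
  have h1 := (mem_toSet_iff J _).mp (h ▸ I.left_mem_toSet)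
  have hl : J.length = I.length := by rw [length, length, hs]
  rw [hl, mul_div_cancel_right₀ _ I.length_pos.ne', Int.floor_intCast] at h1
  cases I; cases J
  simp_all

/-- Dyadic intervals are ordered by inclusion. -/
instance : PartialOrder DyadicInterval := PartialOrder.lift toSet toSet_injective

theorem le_def {I J : DyadicInterval} : I ≤ J ↔ I.toSet ⊆ J.toSet := Iff.rfl

theorem scale_lt_of_lt {I J : DyadicInterval} (h : I < J) : I.scale < J.scale := by
  refine lt_of_le_of_ne (toSet_subset_iff_scale h.le) fun hs => h.not_ge ?_
  refine (subset_or_disjoint hs.ge).resolve_right fun hd => ?_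
  exact Set.disjoint_left.mp hd (h.le I.left_mem_toSet) I.left_mem_toSet

theorem disjoint_of_not_le {I J : DyadicInterval} (h1 : ¬ I ≤ J) (h2 : ¬ J ≤ I) :
    Disjoint I.toSet J.toSet := by
  rcases le_total I.scale J.scale with h | h
  · exact (subset_or_disjoint h).resolve_left h1
  · exact ((subset_or_disjoint h).resolve_left h2).symm

theorem isForest : IsForest DyadicInterval := by
  intro a b c hab hac
  by_contra! h
  exact Set.disjoint_left.mp (disjoint_of_not_le h.1 h.2) (hab a.left_mem_toSet)
    (hac a.left_mem_toSet)

theorem measurableSet_toSet (I : DyadicInterval) : MeasurableSet I.toSet := measurableSet_Ico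

theorem measurable_haar (I : DyadicInterval) : Measurable I.haar :=
  (measurable_const.indicator measurableSet_Ico).sub (measurable_const.indicator measurableSet_Ico)

theorem haar_of_mem_left (I : DyadicInterval) {x : ℝ} (h : x ∈ I.leftHalf) :
    I.haar x = (√I.length)⁻¹ := by
  rw [haar, Set.indicator_of_mem h,
    Set.indicator_of_notMem (Set.disjoint_left.mp I.disjoint_leftHalf_rightHalf h), sub_zero]

theorem haar_of_mem_right (I : DyadicInterval) {x : ℝ} (h : x ∈ I.rightHalf) :
    I.haar x = -(√I.length)⁻¹ := by
  rw [haar, Set.indicator_of_mem h,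
    Set.indicator_of_notMem (Set.disjoint_right.mp I.disjoint_leftHalf_rightHalf h), zero_sub]

theorem haar_of_notMem (I : DyadicInterval) {x : ℝ} (h : x ∉ I.toSet) : I.haar x = 0 := by
  rw [mem_toSet_iff_half, not_or] at h
  rw [haar, Set.indicator_of_notMem h.1, Set.indicator_of_notMem h.2, sub_zero]

theorem abs_haar_of_mem (I : DyadicInterval) {x : ℝ} (h : x ∈ I.toSet) :
    |I.haar x| = (√I.length)⁻¹ := by
  have : 0 ≤ (√I.length)⁻¹ := by positivity
  rcases (mem_toSet_iff_half I x).mp h with h | h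
  · rw [haar_of_mem_left I h, abs_of_nonneg this]
  · rw [haar_of_mem_right I h, abs_neg, abs_of_nonneg this]

theorem haar_sq (I : DyadicInterval) (x : ℝ) :
    I.haar x ^ 2 = I.toSet.indicator (fun _ => I.length⁻¹) x := by
  by_cases h : x ∈ I.toSet
  · rw [← sq_abs, abs_haar_of_mem I h, Set.indicator_of_mem h, inv_pow,
      Real.sq_sqrt I.length_pos.le]
  · rw [haar_of_notMem I h, Set.indicator_of_notMem h]; simp

theorem haar_eq_of_scale_lt {I J : DyadicInterval} (h : I.scale < J.scale) {x y : ℝ}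
    (hx : x ∈ I.toSet) (hy : y ∈ I.toSet) : J.haar x = J.haar y := by
  have e : ⌊x / (J.length / 2)⌋ = ⌊y / (J.length / 2)⌋ := by
    rw [half_length]
    rw [mem_toSet_iff] at hx hy
    exact floor_div_zpow_congr (s := I.scale) (by omega) (hx.trans hy.symm)
  have h1 : x ∈ J.leftHalf ↔ y ∈ J.leftHalf := by rw [mem_leftHalf_iff, mem_leftHalf_iff, e]
  have h2 : x ∈ J.rightHalf ↔ y ∈ J.rightHalf := by rw [mem_rightHalf_iff, mem_rightHalf_iff, e]
  have key : ∀ (s : Set ℝ) (a : ℝ), (x ∈ s ↔ y ∈ s) →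
      s.indicator (fun _ => a) x = s.indicator (fun _ => a) y := fun s a hs => by
    by_cases hm : x ∈ s
    · rw [Set.indicator_of_mem hm, Set.indicator_of_mem (hs.mp hm)]
    · rw [Set.indicator_of_notMem hm, Set.indicator_of_notMem (fun h => hm (hs.mpr h))]
  rw [haar, haar, key _ _ h1, key _ _ h2]

/-- The dyadic interval of twice the length containing `J`. -/
def parent (J : DyadicInterval) : DyadicInterval := ⟨J.scale + 1, J.index / 2⟩

theorem length_parent (J : DyadicInterval) : J.parent.length = 2 * J.length := by
  rw [length, length, parent, zpow_add_one₀ two_ne_zero, mul_comm]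

theorem toSet_subset_parent (J : DyadicInterval) : J.toSet ⊆ J.parent.toSet := by
  intro x hx
  rw [mem_toSet_iff] at *
  have := Int.floor_div_natCast (x / J.length) 2
  rw [hx, div_div, mul_comm, Nat.cast_ofNat, ← length_parent] at this
  exact this

/-- Unlike the Haar function of `J`, that of its parent has no cancellation on `J`, so it detects
the full masses of both weights there. -/
theorem exists_haar_parent (J : DyadicInterval) :
    ∃ c : ℝ, c ^ 2 = (2 * J.length)⁻¹ ∧ ∀ x ∈ J.toSet, J.parent.haar x = c := by
  refine ⟨J.parent.haar (J.index * J.length), ?_, fun x hx =>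
    haar_eq_of_scale_lt (by simp [parent]) hx J.left_mem_toSet⟩
  rw [haar_sq, Set.indicator_of_mem (J.toSet_subset_parent J.left_mem_toSet), length_parent]

end DyadicInterval

/-! ### Haar series in weighted L² as series in unweighted L² -/

section WeightedLp

/-- The element `w^{1/2} φ` of `L²(ℝ)`; zero if this function is not square integrable. -/
noncomputable def weightedLp (w φ : ℝ → ℝ) : Lp ℝ 2 (volume : Measure ℝ) :=
  open Classical in
  if h : MemLp (fun x => √(w x) * φ x) 2 volume then h.toLp _ else 0

/-- Bounded measurable functions supported in a dyadic interval. -/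
def IsDyadicTest (φ : ℝ → ℝ) : Prop :=
  Measurable φ ∧ ∃ (C : ℝ) (I : DyadicInterval), ∀ x, |φ x| ≤ I.toSet.indicator (fun _ => C) x

theorem isDyadicTest_haar (I : DyadicInterval) : IsDyadicTest I.haar := by
  refine ⟨I.measurable_haar, (√I.length)⁻¹, I, fun x => ?_⟩
  by_cases h : x ∈ I.toSet
  · rw [Set.indicator_of_mem h, I.abs_haar_of_mem h]
  · rw [Set.indicator_of_notMem h, I.haar_of_notMem h, abs_zero]

theorem isDyadicTest_indicator (I : DyadicInterval) :
    IsDyadicTest (I.toSet.indicator fun _ => 1) := by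
  refine ⟨measurable_const.indicator I.measurableSet_toSet, 1, I, fun x => ?_⟩
  rw [abs_of_nonneg (Set.indicator_nonneg (fun _ _ => zero_le_one) x)]

variable {w v : ℝ → ℝ}

theorem IsDyadicTest.memLp (hw : LocallyIntegrable w volume) {φ : ℝ → ℝ} (hφ : IsDyadicTest φ) :
    MemLp (fun x => √(w x) * φ x) 2 volume := by
  obtain ⟨hm, C, I, hb⟩ := hφ
  have hmeas : AEStronglyMeasurable (fun x => √(w x) * φ x) volume :=
    (Real.continuous_sqrt.comp_aestronglyMeasurable hw.aestronglyMeasurable).mul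
      hm.aestronglyMeasurable
  rw [memLp_two_iff_integrable_sq hmeas]
  have hint : Integrable (I.toSet.indicator fun x => C ^ 2 * ‖w x‖) volume := by
    rw [integrable_indicator_iff I.measurableSet_toSet]
    refine Integrable.const_mul (Integrable.norm ?_) _
    exact (hw.integrableOn_isCompact isCompact_Icc).mono_set Set.Ico_subset_Icc_self
  refine hint.mono' (hmeas.pow 2) (ae_of_all _ fun x => ?_)
  have hx := hb x
  rw [Real.norm_of_nonneg (sq_nonneg _), mul_pow]
  by_cases h : x ∈ I.toSet
  · rw [Set.indicator_of_mem h] at *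
    have h1 : √(w x) ^ 2 ≤ ‖w x‖ := by
      rcases le_total 0 (w x) with h0 | h0
      · rw [Real.sq_sqrt h0]; exact le_abs_self _
      · rw [Real.sqrt_eq_zero_of_nonpos h0]; simp
    have h2 : φ x ^ 2 ≤ C ^ 2 := by
      rw [← sq_abs]; exact pow_le_pow_left₀ (abs_nonneg _) hx 2
    calc √(w x) ^ 2 * φ x ^ 2 ≤ ‖w x‖ * C ^ 2 := by gcongr
      _ = _ := mul_comm _ _
  · rw [Set.indicator_of_notMem h] at *
    rw [abs_nonpos_iff.mp hx]
    simp

theorem coeFn_weightedLp (hw : LocallyIntegrable w volume) {φ : ℝ → ℝ} (hφ : IsDyadicTest φ) :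
    weightedLp w φ =ᵐ[volume] fun x => √(w x) * φ x := by
  rw [weightedLp, dif_pos (hφ.memLp hw)]
  exact MemLp.coeFn_toLp _

theorem inner_weightedLp_right (hw : LocallyIntegrable w volume) {φ : ℝ → ℝ}
    (hφ : IsDyadicTest φ) (f : Lp ℝ 2 (volume : Measure ℝ)) :
    inner ℝ f (weightedLp w φ) = ∫ x, √(w x) * f x * φ x := by
  rw [L2.inner_def]
  refine integral_congr_ae ?_
  filter_upwards [coeFn_weightedLp hw hφ] with x hx
  rw [hx]
  simp only [RCLike.inner_apply, conj_trivial]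
  ring

theorem inner_weightedLp (hw : LocallyIntegrable w volume) (hw0 : ∀ᵐ x ∂volume, 0 ≤ w x)
    {φ ψ : ℝ → ℝ} (hφ : IsDyadicTest φ) (hψ : IsDyadicTest ψ) :
    inner ℝ (weightedLp w φ) (weightedLp w ψ) = ∫ x, w x * (φ x * ψ x) := by
  rw [inner_weightedLp_right hw hψ]
  refine integral_congr_ae ?_
  filter_upwards [coeFn_weightedLp hw hφ, hw0] with x hx h0
  rw [hx]
  nth_rw 3 [← Real.mul_self_sqrt h0]
  ring

theorem isHaarGram_weightedLp (hw : LocallyIntegrable w volume) (hw0 : ∀ᵐ x ∂volume, 0 ≤ w x) :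
    IsHaarGram (fun I : DyadicInterval => weightedLp w (I.toSet.indicator fun _ => 1))
      (fun I => weightedLp w I.haar) (fun I => ∫ x in I.toSet, w x) DyadicInterval.length := by
  have hi := isDyadicTest_indicator
  have hh := isDyadicTest_haar
  have huu := fun I J => inner_weightedLp hw hw0 (hi I) (hi J)
  have hxx := fun I J => inner_weightedLp hw hw0 (hh I) (hh J)
  have hxu := fun I J => inner_weightedLp hw hw0 (hh I) (hi J)
  have hux := fun I J => inner_weightedLp hw hw0 (hi I) (hh J)
  refine ⟨⟨fun I J hIJ => ?_, fun I J h1 h2 => ?_⟩, fun I J hIJ => ?_, fun I J hIJ => ?_,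
    fun I J h1 h2 => ?_, fun I J h1 h2 => ?_, fun I => ?_⟩
  · rw [huu, ← integral_indicator I.measurableSet_toSet]
    refine integral_congr_ae (ae_of_all _ fun x => ?_)
    by_cases hx : x ∈ I.toSet
    · simp [hx, DyadicInterval.le_def.mp hIJ hx]
    · simp [hx]
  · rw [huu, ← integral_zero ℝ ℝ]
    refine integral_congr_ae (ae_of_all _ fun x => ?_)
    by_cases hx : x ∈ I.toSet
    · simp [Set.disjoint_left.mp (DyadicInterval.disjoint_of_not_le h1 h2) hx]
    · simp [hx]
  · have hc : ∀ x ∈ I.toSet, J.haar x = J.haar (I.index * I.length) := fun x hx =>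
      DyadicInterval.haar_eq_of_scale_lt (DyadicInterval.scale_lt_of_lt hIJ) hx I.left_mem_toSet
    refine ⟨J.haar (I.index * I.length), ?_, ?_⟩
    · rw [hxx, hxu, ← integral_const_mul]
      refine integral_congr_ae (ae_of_all _ fun x => ?_)
      by_cases hx : x ∈ I.toSet
      · simp only [hc x hx, Set.indicator_of_mem hx]; ring
      · simp [I.haar_of_notMem hx]
    · rw [hux, ← integral_indicator I.measurableSet_toSet, ← integral_const_mul]
      refine integral_congr_ae (ae_of_all _ fun x => ?_)
      by_cases hx : x ∈ I.toSet
      · simp only [hc x hx, Set.indicator_of_mem hx]; ring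
      · simp [hx]
  · rw [hxu, hxu]
    refine integral_congr_ae (ae_of_all _ fun x => ?_)
    by_cases hx : x ∈ I.toSet
    · simp [hx, DyadicInterval.le_def.mp hIJ hx]
    · simp [I.haar_of_notMem hx]
  · rw [hxx, ← integral_zero ℝ ℝ]
    refine integral_congr_ae (ae_of_all _ fun x => ?_)
    by_cases hx : x ∈ I.toSet
    · simp [J.haar_of_notMem
        (Set.disjoint_left.mp (DyadicInterval.disjoint_of_not_le h1 h2) hx)]
    · simp [I.haar_of_notMem hx]
  · rw [hxu, ← integral_zero ℝ ℝ]
    refine integral_congr_ae (ae_of_all _ fun x => ?_)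
    by_cases hx : x ∈ I.toSet
    · simp [Set.disjoint_left.mp (DyadicInterval.disjoint_of_not_le h1 h2) hx]
    · simp [I.haar_of_notMem hx]
  · rw [← real_inner_self_eq_norm_sq, hxx, ← integral_indicator I.measurableSet_toSet,
      ← integral_div]
    refine integral_congr_ae (ae_of_all _ fun x => ?_)
    simp only [← pow_two, I.haar_sq]
    by_cases hx : x ∈ I.toSet
    · simp [hx, div_eq_mul_inv]
    · simp [hx]

theorem eLpNorm_weightMeasure (hv : AEStronglyMeasurable v volume) (φ : ℝ → ℝ) :
    eLpNorm φ 2 (weightMeasure v) = eLpNorm (fun x => √(v x) * φ x) 2 volume := by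
  rw [eLpNorm_eq_lintegral_rpow_enorm_toReal two_ne_zero ENNReal.ofNat_ne_top,
    eLpNorm_eq_lintegral_rpow_enorm_toReal two_ne_zero ENNReal.ofNat_ne_top, weightMeasure,
    lintegral_withDensity_eq_lintegral_mul_non_measurable₀ _ hv.aemeasurable.ennreal_ofReal
      (ae_of_all _ fun _ => ENNReal.ofReal_lt_top)]
  congr 1
  refine lintegral_congr fun x => ?_
  simp only [Pi.mul_apply, ENNReal.toReal_ofNat, ENNReal.rpow_ofNat, enorm_mul, mul_pow]
  congr 1
  rw [Real.enorm_of_nonneg (Real.sqrt_nonneg _), ← ENNReal.ofReal_pow (Real.sqrt_nonneg _)]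
  rcases le_total 0 (v x) with h0 | h0
  · rw [Real.sq_sqrt h0]
  · rw [Real.sqrt_eq_zero_of_nonpos h0, ENNReal.ofReal_of_nonpos h0]; simp

/-- Measurability for v dx controls only v g; then √v g is recovered as (√v)⁻¹ (v g), both sides
being zero where √v = 0. -/
theorem aestronglyMeasurable_sqrt_mul (hv : AEStronglyMeasurable v volume) {g : ℝ → ℝ}
    (hg : AEStronglyMeasurable g (weightMeasure v)) :
    AEStronglyMeasurable (fun x => √(v x) * g x) volume := by
  have e : weightMeasure v =
      volume.withDensity fun x => ((Real.toNNReal (hv.mk v x) : NNReal) : ENNReal) :=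
    withDensity_congr_ae (by
      filter_upwards [hv.ae_eq_mk] with x hx
      rw [hx]; rfl)
  rw [e, aestronglyMeasurable_withDensity_iff
    hv.stronglyMeasurable_mk.measurable.real_toNNReal] at hg
  have h2 : AEStronglyMeasurable (fun x => (√(v x))⁻¹) volume :=
    (Real.continuous_sqrt.comp_aestronglyMeasurable hv).aemeasurable.inv.aestronglyMeasurable
  refine (h2.mul hg).congr ?_
  filter_upwards [hv.ae_eq_mk] with x hx
  simp only [← hx, Pi.mul_apply, smul_eq_mul, Real.coe_toNNReal']
  rcases le_or_gt (v x) 0 with h0 | h0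
  · rw [Real.sqrt_eq_zero_of_nonpos h0]; simp
  · rw [max_eq_left h0.le]
    nth_rw 2 [← Real.mul_self_sqrt h0.le]
    have := Real.sqrt_pos.mpr h0
    field_simp

variable {σ : DyadicInterval → ℤˣ} {f g : ℝ → ℝ}

theorem coeFn_sum_weightedLp (hv : LocallyIntegrable v volume) (σ : DyadicInterval → ℤˣ)
    (f : ℝ → ℝ) (F : Finset DyadicInterval) :
    (∑ I ∈ F, ((σ I : ℤ) : ℝ) • I.haarCoeff f • weightedLp v I.haar :
      Lp ℝ 2 (volume : Measure ℝ)) =ᵐ[volume] fun x => √(v x) * haarPartialSum σ f F x := by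
  refine (Lp.coeFn_finsetSum F _).trans ?_
  have h1 : ∀ᵐ x, ∀ I ∈ F,
      (((σ I : ℤ) : ℝ) • I.haarCoeff f • weightedLp v I.haar : Lp ℝ 2 (volume : Measure ℝ)) x =
        √(v x) * (((σ I : ℤ) : ℝ) * I.haarCoeff f * I.haar x) := by
    refine (ae_ball_iff F.countable_toSet).mpr fun I _ => ?_
    rw [smul_smul]
    filter_upwards [Lp.coeFn_smul (((σ I : ℤ) : ℝ) * I.haarCoeff f) (weightedLp v I.haar),
      coeFn_weightedLp hv (isDyadicTest_haar I)] with x hx hx2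
    rw [hx, Pi.smul_apply, hx2, smul_eq_mul]
    ring
  filter_upwards [h1] with x hx
  rw [haarPartialSum, Finset.mul_sum, Finset.sum_apply]
  exact Finset.sum_congr rfl hx

theorem hasSum_weightedLp_iff (hv : LocallyIntegrable v volume) {G : Lp ℝ 2 (volume : Measure ℝ)}
    (hG : G =ᵐ[volume] fun x => √(v x) * g x) :
    HasSum (fun I => ((σ I : ℤ) : ℝ) • I.haarCoeff f • weightedLp v I.haar) G ↔
      Tendsto (fun F : Finset DyadicInterval =>
        eLpNorm (fun x => haarPartialSum σ f F x - g x) 2 (weightMeasure v)) atTop (𝓝 0) := by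
  rw [HasSum, SummationFilter.unconditional_filter, Lp.tendsto_Lp_iff_tendsto_eLpNorm']
  refine iff_of_eq (congrArg (fun q => Tendsto q atTop (𝓝 0)) (funext fun F => ?_))
  rw [eLpNorm_weightMeasure hv.aestronglyMeasurable]
  refine eLpNorm_congr_ae ?_
  filter_upwards [coeFn_sum_weightedLp hv σ f F, hG] with x h1 h2
  rw [Pi.sub_apply, h1, h2]
  ring

theorem HasHaarTransform.exists_hasSum (hv : LocallyIntegrable v volume)
    (h : HasHaarTransform (weightMeasure v) σ f g) :
    ∃ G : Lp ℝ 2 (volume : Measure ℝ), G =ᵐ[volume] (fun x => √(v x) * g x) ∧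
      HasSum (fun I => ((σ I : ℤ) : ℝ) • I.haarCoeff f • weightedLp v I.haar) G := by
  have hm := aestronglyMeasurable_sqrt_mul hv.aestronglyMeasurable h.1
  -- One partial sum at distance less than 1 suffices to put √v g in L².
  obtain ⟨F, hF⟩ := (h.2.eventually (gt_mem_nhds (zero_lt_one (α := ENNReal)))).exists
  rw [eLpNorm_weightMeasure hv.aestronglyMeasurable] at hF
  set S : Lp ℝ 2 (volume : Measure ℝ) :=
    ∑ I ∈ F, ((σ I : ℤ) : ℝ) • I.haarCoeff f • weightedLp v I.haar
  have hS := coeFn_sum_weightedLp hv σ f F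
  have e : (fun x => √(v x) * (haarPartialSum σ f F x - g x)) =ᵐ[volume]
      fun x => S x - √(v x) * g x := by
    filter_upwards [hS] with x hx
    rw [hx]; ring
  have hD : MemLp (fun x => S x - √(v x) * g x) 2 volume :=
    ⟨(Lp.aestronglyMeasurable S).sub hm, by
      rw [← eLpNorm_congr_ae e]; exact hF.trans ENNReal.one_lt_top⟩
  have hg : MemLp (fun x => √(v x) * g x) 2 volume := by
    have := (Lp.memLp S).sub hD
    refine this.ae_eq (ae_of_all _ fun x => ?_)
    simp
  exact ⟨hg.toLp _, hg.coeFn_toLp, (hasSum_weightedLp_iff hv hg.coeFn_toLp).mpr h.2⟩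

/-- The candidate is g = (√v)⁻¹ G. The partial sums vanish where √v = 0, so cutting `G` off there
does not increase its distance to them; uniqueness of the limit then shows that nothing was lost. -/
theorem exists_hasHaarTransform (hv : LocallyIntegrable v volume)
    {G : Lp ℝ 2 (volume : Measure ℝ)}
    (h : HasSum (fun I => ((σ I : ℤ) : ℝ) • I.haarCoeff f • weightedLp v I.haar) G) :
    ∃ g, HasHaarTransform (weightMeasure v) σ f g ∧ G =ᵐ[volume] fun x => √(v x) * g x := by
  have hsv : AEStronglyMeasurable (fun x => (√(v x))⁻¹) volume :=
    (Real.continuous_sqrt.comp_aestronglyMeasurable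
      hv.aestronglyMeasurable).aemeasurable.inv.aestronglyMeasurable
  have hgm : AEStronglyMeasurable (fun x => (√(v x))⁻¹ * G x) volume :=
    hsv.mul (Lp.aestronglyMeasurable G)
  have hmeas : AEStronglyMeasurable (fun x => √(v x) * ((√(v x))⁻¹ * G x)) volume :=
    (Real.continuous_sqrt.comp_aestronglyMeasurable hv.aestronglyMeasurable).mul hgm
  have hmem : MemLp (fun x => √(v x) * ((√(v x))⁻¹ * G x)) 2 volume := by
    refine (Lp.memLp G).mono hmeas (ae_of_all _ fun x => ?_)
    by_cases h0 : √(v x) = 0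
    · simp [h0]
    · rw [mul_inv_cancel_left₀ h0]
  have hsum : HasSum (fun I => ((σ I : ℤ) : ℝ) • I.haarCoeff f • weightedLp v I.haar)
      (hmem.toLp _) := by
    rw [hasSum_weightedLp_iff hv hmem.coeFn_toLp]
    rw [HasSum, SummationFilter.unconditional_filter, Lp.tendsto_Lp_iff_tendsto_eLpNorm'] at h
    refine tendsto_of_tendsto_of_tendsto_of_le_of_le tendsto_const_nhds h (fun _ => zero_le)
      fun F => ?_
    rw [eLpNorm_weightMeasure hv.aestronglyMeasurable]
    refine eLpNorm_mono_ae ?_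
    filter_upwards [coeFn_sum_weightedLp hv σ f F] with x hx
    rw [Pi.sub_apply, hx, mul_sub]
    by_cases h0 : √(v x) = 0
    · simp [h0]
    · rw [mul_inv_cancel_left₀ h0]
  refine ⟨fun x => (√(v x))⁻¹ * G x, ⟨hgm.mono_ac (withDensity_absolutelyContinuous _ _),
    (hasSum_weightedLp_iff hv hmem.coeFn_toLp).mp hsum⟩, ?_⟩
  exact (Lp.ext_iff.mp (h.unique hsum)).trans hmem.coeFn_toLp

theorem isWeightedHaarMultiplier_iff (hv : LocallyIntegrable v volume)
    (hw : LocallyIntegrable w volume)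
    (A : Lp ℝ 2 (volume : Measure ℝ) →L[ℝ] Lp ℝ 2 (volume : Measure ℝ)) :
    IsWeightedHaarMultiplier v w σ A ↔ ∀ f, HasSum (fun I : DyadicInterval => ((σ I : ℤ) : ℝ) •
      inner ℝ f (weightedLp w I.haar) • weightedLp v I.haar) (A f) := by
  have hc : ∀ (f : Lp ℝ 2 (volume : Measure ℝ)) (I : DyadicInterval),
      inner ℝ f (weightedLp w I.haar) = I.haarCoeff fun x => √(w x) * f x := fun f I =>
    inner_weightedLp_right hw (isDyadicTest_haar I) f
  refine forall_congr' fun f => ?_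
  simp_rw [hc]
  constructor
  · rintro ⟨g, hg, hA⟩
    exact (hasSum_weightedLp_iff hv hA).mpr hg.2
  · exact exists_hasHaarTransform hv

theorem haarMultipliersUniformlyBounded_iff (hv : LocallyIntegrable v volume)
    (hw : LocallyIntegrable w volume) :
    HaarMultipliersUniformlyBounded v w ↔ ∃ C, 0 ≤ C ∧
      AbsBilinearBound (fun I : DyadicInterval => weightedLp w I.haar)
        (fun I => weightedLp v I.haar) C := by
  simp only [HaarMultipliersUniformlyBounded, isWeightedHaarMultiplier_iff hv hw]
  constructor
  · rintro ⟨C, h⟩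
    obtain ⟨A, _, hA⟩ := h fun _ => 1
    exact ⟨C, (norm_nonneg A).trans hA, AbsBilinearBound.of_hasSum h⟩
  · rintro ⟨C, hC, h⟩
    exact ⟨C, h.exists_clm hC⟩

end WeightedLp

/-! ### Testing conditions and the product bound on masses -/

section Testing

variable {w v : ℝ → ℝ}

theorem norm_sq_eq_integral_sq (G : Lp ℝ 2 (volume : Measure ℝ)) : ‖G‖ ^ 2 = ∫ x, G x ^ 2 := by
  rw [← real_inner_self_eq_norm_sq, L2.inner_def]
  refine integral_congr_ae (ae_of_all _ fun x => ?_)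
  simp [pow_two]

theorem length_inv_mul_le_mul_average_iff (J : DyadicInterval) {a C : ℝ} :
    J.length⁻¹ * a ≤ C * J.average w ↔ a ≤ C * ∫ x in J.toSet, w x := by
  rw [DyadicInterval.average, mul_left_comm]
  exact mul_le_mul_iff_right₀ (inv_pos.mpr J.length_pos)

theorem inner_haar_indicator (hw : LocallyIntegrable w volume) (hw0 : ∀ᵐ x ∂volume, 0 ≤ w x)
    (I J : DyadicInterval) :
    inner ℝ (weightedLp w I.haar) (weightedLp w (J.toSet.indicator fun _ => 1)) =
      I.haarCoeff (J.toSet.indicator w) := by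
  rw [inner_weightedLp hw hw0 (isDyadicTest_haar I) (isDyadicTest_indicator J)]
  refine integral_congr_ae (ae_of_all _ fun x => ?_)
  by_cases hx : x ∈ J.toSet <;> simp [hx]

theorem weightMeasure_restrict (v : ℝ → ℝ) (J : DyadicInterval) :
    (weightMeasure v).restrict J.toSet = weightMeasure (J.toSet.indicator v) := by
  rw [weightMeasure, weightMeasure, restrict_withDensity J.measurableSet_toSet,
    ← withDensity_indicator J.measurableSet_toSet]
  congr 1
  funext x
  by_cases hx : x ∈ J.toSet <;> simp [hx]

theorem AbsBilinearBound.haarTesting (hv : LocallyIntegrable v volume)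
    (hw : LocallyIntegrable w volume) (hv0 : ∀ᵐ x ∂volume, 0 ≤ v x)
    (hw0 : ∀ᵐ x ∂volume, 0 ≤ w x) {C : ℝ} (hC : 0 ≤ C)
    (h : AbsBilinearBound (fun I : DyadicInterval => weightedLp w I.haar)
      (fun I => weightedLp v I.haar) C) : HaarTesting v w := by
  refine ⟨C ^ 2, fun J σ => ?_⟩
  obtain ⟨A, hA, hAC⟩ := h.exists_clm hC σ
  have hsum := hA (weightedLp w (J.toSet.indicator fun _ => 1))
  simp_rw [real_inner_comm (weightedLp w (DyadicInterval.haar _)),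
    inner_haar_indicator hw hw0] at hsum
  obtain ⟨g, hg, hAg⟩ := exists_hasHaarTransform hv hsum
  set G := A (weightedLp w (J.toSet.indicator fun _ => 1))
  refine ⟨g, ⟨hg.1.mono_measure Measure.restrict_le_self,
    tendsto_of_tendsto_of_tendsto_of_le_of_le tendsto_const_nhds hg.2 (fun _ => zero_le)
      fun F => eLpNorm_mono_measure _ Measure.restrict_le_self⟩, ?_⟩
  rw [length_inv_mul_le_mul_average_iff]
  calc ∫ x in J.toSet, |g x| ^ 2 * v x = ∫ x in J.toSet, G x ^ 2 := by
        refine integral_congr_ae (ae_restrict_of_ae ?_)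
        filter_upwards [hAg, hv0] with x hx h0
        rw [hx, mul_pow, Real.sq_sqrt h0, sq_abs, mul_comm]
    _ ≤ ∫ x, G x ^ 2 :=
        setIntegral_le_integral ((memLp_two_iff_integrable_sq (Lp.aestronglyMeasurable G)).mp
          (Lp.memLp G)) (ae_of_all _ fun x => sq_nonneg _)
    _ = ‖G‖ ^ 2 := (norm_sq_eq_integral_sq G).symm
    _ ≤ (C * ‖weightedLp w (J.toSet.indicator fun _ => 1)‖) ^ 2 := by
        gcongr
        exact (A.le_opNorm _).trans (by gcongr)
    _ = C ^ 2 * ∫ x in J.toSet, w x := by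
        rw [mul_pow, (isHaarGram_weightedLp hw hw0).norm_sq]

/-- Convergence is only known in L²(J, v dx), so the output weight is truncated to χ_J v. Signs
adapted to `φ` then give the absolute sum. -/
theorem HaarTesting.exists_sum_le (hv : LocallyIntegrable v volume)
    (hw : LocallyIntegrable w volume) (hv0 : ∀ᵐ x ∂volume, 0 ≤ v x)
    (hw0 : ∀ᵐ x ∂volume, 0 ≤ w x) (h : HaarTesting v w) :
    ∃ K, 0 ≤ K ∧ ∀ (J : DyadicInterval) (F : Finset DyadicInterval)
      (φ : Lp ℝ 2 (volume : Measure ℝ)),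
      ∑ I ∈ F, |inner ℝ (weightedLp w I.haar) (weightedLp w (J.toSet.indicator fun _ => 1))| *
        |inner ℝ φ (weightedLp (J.toSet.indicator v) I.haar)| ≤
          K * √(∫ x in J.toSet, w x) * ‖φ‖ := by
  obtain ⟨C, hC⟩ := h
  -- The testing constant is not assumed nonnegative.
  refine ⟨√|C|, Real.sqrt_nonneg _, fun J F φ => ?_⟩
  have hwJ : 0 ≤ ∫ x in J.toSet, w x := (isHaarGram_weightedLp hw hw0).nonneg J
  have hvJ : LocallyIntegrable (J.toSet.indicator v) volume :=
    hv.indicator J.measurableSet_toSet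
  have := sum_abs_inner_le_of_signed_hasSum
    (fun I : DyadicInterval =>
      I.haarCoeff (J.toSet.indicator w) • weightedLp (J.toSet.indicator v) I.haar)
    (√|C| * √(∫ x in J.toSet, w x)) (fun σ => by
      obtain ⟨g, hg, hgC⟩ := hC J σ
      rw [weightMeasure_restrict] at hg
      obtain ⟨G, hGg, hG⟩ := hg.exists_hasSum hvJ
      refine ⟨G, hG, ?_⟩
      rw [length_inv_mul_le_mul_average_iff] at hgC
      rw [← Real.sqrt_mul (abs_nonneg C)]
      refine Real.le_sqrt_of_sq_le ?_
      calc ‖G‖ ^ 2 = ∫ x, G x ^ 2 := norm_sq_eq_integral_sq G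
        _ = ∫ x in J.toSet, |g x| ^ 2 * v x := by
            rw [← integral_indicator J.measurableSet_toSet]
            refine integral_congr_ae ?_
            filter_upwards [hGg, hv0] with x hx h0
            rw [hx, mul_pow]
            by_cases hxJ : x ∈ J.toSet
            · simp [hxJ, Real.sq_sqrt h0, mul_comm]
            · simp [hxJ]
        _ ≤ C * ∫ x in J.toSet, w x := hgC
        _ ≤ |C| * ∫ x in J.toSet, w x := by gcongr; exact le_abs_self C) φ F
  simpa [inner_smul_right, abs_mul, inner_haar_indicator hw hw0] using this

theorem weightedLp_indicator_haar_of_le (hv : LocallyIntegrable v volume) {I J : DyadicInterval}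
    (h : I ≤ J) : weightedLp (J.toSet.indicator v) I.haar = weightedLp v I.haar := by
  refine Lp.ext ?_
  filter_upwards [coeFn_weightedLp hv (isDyadicTest_haar I),
    coeFn_weightedLp (hv.indicator J.measurableSet_toSet) (isDyadicTest_haar I)] with x h1 h2
  rw [h1, h2]
  by_cases hx : x ∈ I.toSet
  · rw [Set.indicator_of_mem (h hx)]
  · simp [I.haar_of_notMem hx]

theorem inner_indicator_haar_parent (hv : LocallyIntegrable v volume)
    (hv0 : ∀ᵐ x ∂volume, 0 ≤ v x) (J : DyadicInterval) {c : ℝ}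
    (hc : ∀ x ∈ J.toSet, J.parent.haar x = c) :
    inner ℝ (weightedLp v (J.toSet.indicator fun _ => 1))
      (weightedLp (J.toSet.indicator v) J.parent.haar) = c * ∫ x in J.toSet, v x := by
  rw [inner_weightedLp_right (hv.indicator J.measurableSet_toSet) (isDyadicTest_haar _),
    ← integral_indicator J.measurableSet_toSet, ← integral_const_mul]
  refine integral_congr_ae ?_
  filter_upwards [coeFn_weightedLp hv (isDyadicTest_indicator J), hv0] with x hx h0
  rw [hx]
  by_cases hxJ : x ∈ J.toSet
  · simp only [Set.indicator_of_mem hxJ, hc x hxJ, mul_one, Real.mul_self_sqrt h0, mul_comm c]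
  · simp [hxJ]

/-- Only the parent term is kept, with φ = v^{1/2} χ_J. Its Haar function is a constant c on `J`
with c² = 1 / (2|J|), so w(J) v(J) / (2|J|) ≤ K √(w(J) v(J)). -/
theorem integral_mul_integral_le_of_testing (hv : LocallyIntegrable v volume)
    (hw : LocallyIntegrable w volume) (hv0 : ∀ᵐ x ∂volume, 0 ≤ v x)
    (hw0 : ∀ᵐ x ∂volume, 0 ≤ w x) {K : ℝ}
    (h : ∀ (J : DyadicInterval) (F : Finset DyadicInterval) (φ : Lp ℝ 2 (volume : Measure ℝ)),
      ∑ I ∈ F, |inner ℝ (weightedLp w I.haar) (weightedLp w (J.toSet.indicator fun _ => 1))| *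
        |inner ℝ φ (weightedLp (J.toSet.indicator v) I.haar)| ≤
          K * √(∫ x in J.toSet, w x) * ‖φ‖) (J : DyadicInterval) :
    (∫ x in J.toSet, w x) * ∫ x in J.toSet, v x ≤ (2 * K * J.length) ^ 2 := by
  obtain ⟨c, hc2, hc⟩ := J.exists_haar_parent
  have hJ := J.length_pos
  have hwJ : 0 ≤ ∫ x in J.toSet, w x := (isHaarGram_weightedLp hw hw0).nonneg J
  have hvJ : 0 ≤ ∫ x in J.toSet, v x := (isHaarGram_weightedLp hv hv0).nonneg J
  have hnorm := (isHaarGram_weightedLp hv hv0).norm_sq J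
  have h1 := h J {J.parent} (weightedLp v (J.toSet.indicator fun _ => 1))
  have hcw : inner ℝ (weightedLp w J.parent.haar) (weightedLp w (J.toSet.indicator fun _ => 1)) =
      c * ∫ x in J.toSet, w x := by
    rw [inner_weightedLp hw hw0 (isDyadicTest_haar _) (isDyadicTest_indicator J),
      ← integral_indicator J.measurableSet_toSet, ← integral_const_mul]
    refine integral_congr_ae (ae_of_all _ fun x => ?_)
    by_cases hxJ : x ∈ J.toSet
    · simp [hxJ, hc x hxJ, mul_comm]
    · simp [hxJ]
  rw [Finset.sum_singleton, hcw, inner_indicator_haar_parent hv hv0 J hc, ← abs_mul,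
    ← Real.sqrt_sq (norm_nonneg (weightedLp v _)), hnorm] at h1
  set W := ∫ x in J.toSet, w x
  set V := ∫ x in J.toSet, v x
  have e : c * W * (c * V) = (2 * J.length)⁻¹ * (W * V) := by rw [← hc2]; ring
  rw [e, abs_of_nonneg (by positivity), inv_mul_le_iff₀ (by positivity), mul_assoc K,
    ← Real.sqrt_mul hwJ] at h1
  have hs := Real.mul_self_sqrt (mul_nonneg hwJ hvJ)
  rcases (Real.sqrt_nonneg (W * V)).eq_or_lt with h0 | h0
  · rw [← hs, ← h0]; simp only [mul_zero]; positivity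
  · have h2 : √(W * V) ≤ 2 * K * J.length := by
      refine le_of_mul_le_mul_right ?_ h0
      rw [hs]
      linarith
    rw [← hs, ← pow_two]
    exact pow_le_pow_left₀ h0.le h2 2

open Classical in
theorem exists_absBilinearBound_of_haarTesting (hv : LocallyIntegrable v volume)
    (hw : LocallyIntegrable w volume) (hv0 : ∀ᵐ x ∂volume, 0 ≤ v x)
    (hw0 : ∀ᵐ x ∂volume, 0 ≤ w x) (h : HaarTesting v w) (h' : HaarTesting w v) :
    ∃ C, 0 ≤ C ∧ AbsBilinearBound (fun I : DyadicInterval => weightedLp w I.haar)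
      (fun I => weightedLp v I.haar) C := by
  obtain ⟨K₁, hK₁, h₁⟩ := h.exists_sum_le hv hw hv0 hw0
  obtain ⟨K₂, hK₂, h₂⟩ := h'.exists_sum_le hw hv hw0 hv0
  have gw := isHaarGram_weightedLp hw hw0
  have gv := isHaarGram_weightedLp hv hv0
  refine ⟨_, ?_, gw.absBilinearBound DyadicInterval.isForest gv DyadicInterval.length_pos
    (K := K₁ + K₂) (B := 2 * K₁) (by positivity) (by positivity)
    (integral_mul_integral_le_of_testing hv hw hv0 hw0 h₁)
    (fun F J φ => ?_) (fun F J φ => ?_)⟩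
  · positivity
  · calc _ = ∑ I ∈ F with I ≤ J,
          |inner ℝ (weightedLp w I.haar) (weightedLp w (J.toSet.indicator fun _ => 1))| *
            |inner ℝ φ (weightedLp (J.toSet.indicator v) I.haar)| := by
          refine Finset.sum_congr rfl fun I hI => ?_
          have hIJ := (Finset.mem_filter.mp hI).2
          -- For `I ≤ J` the Haar function of `I` lives inside `J`, so both truncations to `J`
          -- disappear.
          rw [weightedLp_indicator_haar_of_le hv hIJ, gw.inner_indicator I J hIJ]
      _ ≤ _ := h₁ J _ φ
      _ ≤ _ := by gcongr; linarith
  · calc _ = ∑ I ∈ F with I ≤ J,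
          |inner ℝ (weightedLp v I.haar) (weightedLp v (J.toSet.indicator fun _ => 1))| *
            |inner ℝ φ (weightedLp (J.toSet.indicator w) I.haar)| := by
          refine Finset.sum_congr rfl fun I hI => ?_
          have hIJ := (Finset.mem_filter.mp hI).2
          rw [weightedLp_indicator_haar_of_le hw hIJ, gv.inner_indicator I J hIJ]
      _ ≤ _ := h₂ J _ φ
      _ ≤ _ := by gcongr; linarith

end Testing

theorem theorem0p1 (v w : ℝ → ℝ)
    (hv : LocallyIntegrable v volume) (hw : LocallyIntegrable w volume)
    (hv0 : ∀ᵐ x ∂volume, 0 ≤ v x) (hw0 : ∀ᵐ x ∂volume, 0 ≤ w x) :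
    HaarMultipliersUniformlyBounded v w ↔ HaarTesting v w ∧ HaarTesting w v := by
  rw [haarMultipliersUniformlyBounded_iff hv hw]
  constructor
  · rintro ⟨C, hC, h⟩
    exact ⟨h.haarTesting hv hw hv0 hw0 hC, h.symm.haarTesting hw hv hw0 hv0 hC⟩
  · rintro ⟨h, h'⟩
    exact exists_absBilinearBound_of_haarTesting hv hw hv0 hw0 h h'
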